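/- **Setting.** All graphs are finite, simple and undirected. A labelling of $G=(V,E)$ assigns to every edge a finite (possibly empty) set of labels in $\mathbb N$. A vertex $u$ can reach $v$ if some walk from $u$ to $v$ admits strictly increasing labels, one on each of its successive edges; the labelling is temporally connected if every vertex can reach every vertex. It is proper if distinct edges with a common endpoint share no label, and minimal if the removal of any single label from any single edge changes the reachability graph (the digraph of all pairs $(u,v)$ such that $u$ can reach $v$) up to isomorphism. The temporal cost of a labelling is its total number of labels, and its temporality is the maximum number of labels on an edge. $T^+(G)$ and $\tau^+(G)$ are the maximum temporal cost and the maximum temporality over all proper minimal temporally connected labellings of $G$. For a class $\mathcal C$ of graphs, $T^+(\mathcal C)$ and $\tau^+(\mathcal C)$ are the maximum $x$ such that $T^+(G)\ge x$, respectively $\tau^+(G)\ge x$, for all $G\in\mathcal C$. A cactus is a connected graph in which every edge lies on at most one simple cycle. Its circumference $c$ is the size of a largest simple cycle, with $c=2$ if there is no cycle. **Pivot labelling** of a tree on $n$ vertices. Choose a pivot $p$. List the other vertices in order of non-increasing distance to $p$, and give label $i$ to the edge from the $i$-th vertex towards $p$, for $i=1,\dots,n-1$. Let $v'$ be the last vertex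 of this list. List the vertices other than $p$ again, in order of non-decreasing distance to $p$, and give label $(n-1)+j$ to the edge from the $j$-th vertex towards $p$. Finally remove the larger label of the edge $\{v',p\}$. **Generator labelling** of a cycle of size $c\ge 3$. Number the edges $0,\dots,c-1$ clockwise from a chosen edge. In round $r=0,\dots,\lfloor c/2\rfloor$ let $e_c$ be the edge $r$ and $e_{cc}$ the edge $-r \bmod c$. To distribute a list alternately means to give its 1st, 3rd, 5th, … entries to one of these two edges and the other entries to the other one. To update a pair of lists $(L',L)$ means to move the smallest entry of $L$ to the end of $L'$ and then to remove the largest remaining entry of $L$ (if there is one). * *$c$ even.* Let $L_1$ and $L_2$ be the increasing lists of the odd and of the even numbers in $\{1,\dots,c-1\}$, and let $L_1',L_2'$ be empty. Round $r$ uses $(L',L)=(L_1',L_1)$ if $r$ is even and $(L_2',L_2)$ if $r$ is odd: give all labels of $L'$ to both $e_c$ and $e_{cc}$, distribute $L$ alternately starting with $e_c$, and update $(L',L)$. After the last round, where $e_c=e_{cc}=e'$, add the label $\ell+2$ to $e'$, where $\ell$ is the largest label on $e'$. * *$c$ odd.* Let $L_1$ and $L_2$ be the increasing lists of the odd and of the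 even numbers in $\{1,\dots,c\}$, and let $L'$ be empty. In round $0$ give all labels of $L_1$ to edge $0$ and remove the largest entry of $L_1$. In round $1$ distribute $L_2$ alternately starting with $e_c$ and remove the largest entry of $L_2$. In round $r\ge 2$ let $L=L_1$ if $r$ is even and $L=L_2$ if $r$ is odd; distribute the concatenation of $L'$ and $L$ alternately, starting with $e_{cc}$ if $r$ is even and with $e_c$ if $r$ is odd, and update $(L',L)$. **Combined labelling** of a cactus on $n$ vertices with circumference $c$. If there is no cycle, it is a pivot labelling. Otherwise let $C$ be a largest simple cycle, contract $C$ to a vertex $v_C$, and let $T$ be a spanning tree of the contracted graph, whose edges are regarded as edges of $G$. (1) With labels $1,\dots,n-c$, label $T$ by the first pass of the pivot labelling with pivot $v_C$. (2) Label $C$ by the generator labelling, with all labels increased by $n-c$; let $L$ be the maximum label $(n-c)+\max(\text{generator label})$. (3) Label $T$ by the second pass of the pivot labelling, with labels $(n-c)+j+(L+1)$ for $j=1,\dots,n-c$; no label is removed. **Theorem.** Let $n\ge 2$ and let $G$ be a cactus on $n$ vertices with circumference $c$. Then $G$ has a combined labelling. Every combined labelling of $G$, for all choices made in its construction, is proper,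 minimal and temporally connected, has at least $\tfrac14c^2+2(n-c)$ labels, and has temporality at least $\lceil \tfrac12 c\rceil$. Consequently, if the class $\mathcal C_{n,c}$ of cacti on $n$ vertices with circumference $c$ is non-empty, then $$T^+(\mathcal C_{n,c})\ \ge\ \tfrac14c^2+2(n-c)\qquad\text{and}\qquad \tau^+(\mathcal C_{n,c})\ \ge\ \lceil \tfrac12 c\rceil .$$ -/

import Mathlib

/-! ### Temporal graphs -/

namespace TemporalGraph

open SimpleGraph

variable {V : Type*}

/-- `u` can reach `v`: there is a walk from `u` to `v` in the footprint, together with strictly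
increasing times `ts`, such that the `i`-th edge of the walk carries the `i`-th time as a label. -/
def Reaches {G : SimpleGraph V} (lam : G.EdgeLabeling (Finset ℕ)) (u v : V) : Prop :=
  ∃ (p : G.Walk u v) (ts : List ℕ),
    List.Forall₂ (fun e t => ∃ h : e ∈ G.edgeSet, t ∈ lam ⟨e, h⟩) p.edges ts ∧
    ts.Pairwise (· < ·)

/-- Every vertex can reach every vertex. -/
def IsTemporallyConnected {G : SimpleGraph V} (lam : G.EdgeLabeling (Finset ℕ)) : Prop :=
  ∀ u v, Reaches lam u v

/-- Distinct edges with a common endpoint have no label in common. -/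
def IsProper {G : SimpleGraph V} (lam : G.EdgeLabeling (Finset ℕ)) : Prop :=
  ∀ e f : G.edgeSet, e ≠ f → (∃ v, v ∈ (e : Sym2 V) ∧ v ∈ (f : Sym2 V)) → Disjoint (lam e) (lam f)

open Classical in
/-- The labelling without the single label `t` on the edge `e`. -/
noncomputable def removeLabel {G : SimpleGraph V} (lam : G.EdgeLabeling (Finset ℕ))
    (e : G.edgeSet) (t : ℕ) : G.EdgeLabeling (Finset ℕ) :=
  Function.update lam e ((lam e).erase t)

/-- The reachability graphs are isomorphic. -/
def ReachabilityEquivalent {G : SimpleGraph V} (lam mu : G.EdgeLabeling (Finset ℕ)) : Prop :=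
  Nonempty (Reaches lam ≃r Reaches mu)

/-- Every label is necessary: its removal changes the reachability graph. -/
def IsMinimal {G : SimpleGraph V} (lam : G.EdgeLabeling (Finset ℕ)) : Prop :=
  ∀ e : G.edgeSet, ∀ t ∈ lam e, ¬ ReachabilityEquivalent lam (removeLabel lam e t)

open Classical in
/-- The total number of labels. -/
noncomputable def temporalCost [Fintype V] {G : SimpleGraph V}
    (lam : G.EdgeLabeling (Finset ℕ)) : ℕ :=
  ∑ e : G.edgeSet, (lam e).card

open Classical in
/-- The maximum number of labels on an edge. -/
noncomputable def temporality [Fintype V] {G : SimpleGraph V}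
    (lam : G.EdgeLabeling (Finset ℕ)) : ℕ :=
  Finset.univ.sup fun e : G.edgeSet => (lam e).card

/-- The maximum temporal cost `T⁺(G)` over all proper minimal labellings of `G` that make it
temporally connected. -/
noncomputable def maxTemporalCost [Fintype V] (G : SimpleGraph V) : ℕ :=
  sSup {k | ∃ lam : G.EdgeLabeling (Finset ℕ),
    IsProper lam ∧ IsMinimal lam ∧ IsTemporallyConnected lam ∧ temporalCost lam = k}

/-- The maximum temporality `τ⁺(G)` over all proper minimal labellings of `G` that make it
temporally connected. -/
noncomputable def maxTemporality [Fintype V] (G : SimpleGraph V) : ℕ :=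
  sSup {k | ∃ lam : G.EdgeLabeling (Finset ℕ),
    IsProper lam ∧ IsMinimal lam ∧ IsTemporallyConnected lam ∧ temporality lam = k}

/-- `T⁺` of a class: the maximum `x` such that `T⁺(G) ≥ x` for all graphs `G` of the class. -/
noncomputable def classMaxTemporalCost [Fintype V] (K : Set (SimpleGraph V)) : ℕ :=
  sSup {x | ∀ G ∈ K, x ≤ maxTemporalCost G}

/-- `τ⁺` of a class: the maximum `x` such that `τ⁺(G) ≥ x` for all graphs `G` of the class. -/
noncomputable def classMaxTemporality [Fintype V] (K : Set (SimpleGraph V)) : ℕ :=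
  sSup {x | ∀ G ∈ K, x ≤ maxTemporality G}

/-! ### Cactus graphs -/

/-- A connected graph in which any two simple cycles that share an edge have the same edges. -/
def IsCactus (G : SimpleGraph V) : Prop :=
  G.Connected ∧ ∀ (u v : V) (p : G.Walk u u) (q : G.Walk v v), p.IsCycle → q.IsCycle →
    ∀ e, e ∈ p.edges → e ∈ q.edges → ∀ f, f ∈ p.edges ↔ f ∈ q.edges

open Classical in
/-- The length of a longest simple cycle; by convention `2` if there is no cycle (an edge counts as
a cycle of size two). -/
noncomputable def circumference (G : SimpleGraph V) : ℕ :=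
  if G.IsAcyclic then 2 else sSup {k | ∃ (v : V) (p : G.Walk v v), p.IsCycle ∧ p.length = k}

/-- The cactus graphs with circumference `c` on the vertex set `V`. -/
def circumferenceCacti (V : Type*) (c : ℕ) : Set (SimpleGraph V) :=
  {G | IsCactus G ∧ circumference G = c}

/-! ### The pivot labelling of a tree -/

/-- `pos` numbers the vertices other than `p` by `1, …, |V| - 1`, treating the vertices that are
further away from `p` first. -/
def IsReverseBFSOrder (T : SimpleGraph V) (p : V) (pos : V → ℕ) : Prop :=
  Set.BijOn pos {v | v ≠ p} (Set.Icc 1 (Nat.card V - 1)) ∧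
  ∀ u v, u ≠ p → v ≠ p → T.dist p v < T.dist p u → pos u < pos v

/-- `pos` numbers the vertices other than `p` by `1, …, |V| - 1`, treating the vertices that are
closer to `p` first. -/
def IsBFSOrder (T : SimpleGraph V) (p : V) (pos : V → ℕ) : Prop :=
  Set.BijOn pos {v | v ≠ p} (Set.Icc 1 (Nat.card V - 1)) ∧
  ∀ u v, u ≠ p → v ≠ p → T.dist p u < T.dist p v → pos u < pos v

/-- `e` is the edge closest to `v` on the path from `v` to `p` in `T`. -/
def IsEdgeTowards (T : SimpleGraph V) (p v : V) (e : Sym2 V) : Prop :=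
  ∃ q : T.Walk v p, q.IsPath ∧ q.edges.head? = some e

/-- The pivot labelling of a tree with pivot `p`: the first pass gives the label `fst v` to the edge
from `v` towards `p`, the second pass gives it the label `(n - 1) + snd v`; the second (that is, the
largest) label is removed on the edge of the last vertex `v'` of the first pass, `fst v' = n - 1`. -/
def IsPivotLabelling {G : SimpleGraph V} (lam : G.EdgeLabeling (Finset ℕ)) : Prop :=
  ∃ (p : V) (fst snd : V → ℕ), IsReverseBFSOrder G p fst ∧ IsBFSOrder G p snd ∧
    ∀ (e : G.edgeSet) (t : ℕ), t ∈ lam e ↔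
      (∃ v, IsEdgeTowards G p v e ∧ t = fst v) ∨
      (∃ v, IsEdgeTowards G p v e ∧ fst v ≠ Nat.card V - 1 ∧ t = (Nat.card V - 1) + snd v)

/-! ### The generator labelling of a cycle

The edges of a cycle of size `c` are numbered `0, …, c - 1` in clockwise order from the edge `e`
where the process starts. In round `r` the clockwise edge is `r` and the counter-clockwise edge is
`-r` modulo `c`. -/

/-- The first, third, fifth, … entries of a list. -/
def everySecond : List ℕ → List ℕ
  | [] => []
  | [a] => [a]
  | a :: _ :: l => a :: everySecond l

/-- All odd natural numbers between `1` and `m` included, in increasing order. -/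
def oddsUpTo (m : ℕ) : List ℕ := (List.range (m + 1)).filter (fun k => k % 2 = 1)

/-- All even natural numbers between `1` and `m` included, in increasing order. -/
def evensUpTo (m : ℕ) : List ℕ := (List.range (m + 1)).filter (fun k => k % 2 = 0 ∧ k ≠ 0)

/-- From `(L', L)`: move the smallest label from `L` to `L'` and remove the largest from `L`. -/
def moveLabels : List ℕ × List ℕ → List ℕ × List ℕ
  | (L', []) => (L', [])
  | (L', a :: L) => (L' ++ [a], L.dropLast)

/-- For even `c`, the pair `(L'₁, L₁)` (`r` even) or `(L'₂, L₂)` (`r` odd) at the start of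
round `r`. -/
def evenState (c r : ℕ) : List ℕ × List ℕ :=
  moveLabels^[r / 2] ([], if r % 2 = 0 then oddsUpTo (c - 1) else evensUpTo (c - 1))

/-- For odd `c`, the lists `(L', A, B)` at the start of round `r + 2`, where `A` is the one of
`L₁`, `L₂` that is used in this round and `B` is the other one. -/
def oddState (c : ℕ) : ℕ → List ℕ × List ℕ × List ℕ
  | 0 => ([], (oddsUpTo c).dropLast, (evensUpTo c).dropLast)
  | r + 1 =>
    let s := oddState c r
    let m := moveLabels (s.1, s.2.1)
    (m.1, s.2.2, m.2)

/-- The labels given in round `r` to the clockwise edge and to the counter-clockwise edge. -/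
def generatorRound (c r : ℕ) : List ℕ × List ℕ :=
  if c % 2 = 0 then
    let s := evenState c r
    (s.1 ++ everySecond s.2, s.1 ++ everySecond s.2.tail)
  else match r with
    | 0 => (oddsUpTo c, oddsUpTo c)
    | 1 => (everySecond (evensUpTo c), everySecond (evensUpTo c).tail)
    | r + 2 =>
      let l := (oddState c r).1 ++ (oddState c r).2.1
      if r % 2 = 0 then (everySecond l.tail, everySecond l)
      else (everySecond l, everySecond l.tail)

/-- The labels given by the rounds `0, …, ⌊c / 2⌋` to the edge with number `i`. -/
def generatorRoundLabels (c i : ℕ) : Finset ℕ :=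
  (if i ≤ c / 2 then (generatorRound c i).1.toFinset else ∅) ∪
  (if (c - i) % c ≤ c / 2 then (generatorRound c ((c - i) % c)).2.toFinset else ∅)

/-- The labels of the generator labelling of a cycle of size `c` on the edge with number `i`. For
even `c` the last edge `c / 2` finally receives the label `ℓ + 2`, where `ℓ` is its largest label. -/
def generatorLabels (c i : ℕ) : Finset ℕ :=
  if c % 2 = 0 ∧ i = c / 2 then
    insert ((generatorRoundLabels c i).sup id + 2) (generatorRoundLabels c i)
  else generatorRoundLabels c i

/-- The largest label of the generator labelling of a cycle of size `c`. -/
def generatorMax (c : ℕ) : ℕ := (Finset.range c).sup fun i => (generatorLabels c i).sup id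

/-! ### The combined labelling of a cactus graph -/

open Classical in
/-- The map that contracts the vertex set `S` to the supervertex `none`. -/
noncomputable def contractMap (S : Set V) (v : V) : Option {v : V // v ∉ S} :=
  if h : v ∈ S then none else some ⟨v, h⟩

/-- The combined labelling of a graph with a simple cycle. The closed walk `C` is a largest simple
cycle, with its first edge as the start of the generator labelling and its direction as the
clockwise one; `T` is a spanning tree of the graph with `C` contracted to the vertex `none`, the
pivot. The three cases are the labels of the three steps; `(n - c) + generatorMax c` is the maximum
label `L` used in the first two. -/
def IsCycleCombinedLabelling {G : SimpleGraph V} (lam : G.EdgeLabeling (Finset ℕ)) : Prop :=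
  ∃ (r : V) (C : G.Walk r r), C.IsCycle ∧ C.length = circumference G ∧
  ∃ T : SimpleGraph (Option {v : V // v ∉ {v | v ∈ C.support}}),
    T ≤ G.map (contractMap {v | v ∈ C.support}) ∧ T.IsTree ∧
  ∃ fst snd : Option {v : V // v ∉ {v | v ∈ C.support}} → ℕ,
    IsReverseBFSOrder T none fst ∧ IsBFSOrder T none snd ∧
    let n := Nat.card V
    let c := circumference G
    let L := (n - c) + generatorMax c
    ∀ (e : G.edgeSet) (t : ℕ), t ∈ lam e ↔
      (∃ v, IsEdgeTowards T none v (Sym2.map (contractMap {v | v ∈ C.support}) e) ∧ t = fst v) ∨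
      (∃ i, C.edges[i]? = some (e : Sym2 V) ∧ ∃ s ∈ generatorLabels c i, t = s + (n - c)) ∨
      (∃ v, IsEdgeTowards T none v (Sym2.map (contractMap {v | v ∈ C.support}) e) ∧
        t = (n - c) + snd v + (L + 1))

/-- The combined labelling: the pivot labelling if the graph has no cycle. -/
def IsCombinedLabelling {G : SimpleGraph V} (lam : G.EdgeLabeling (Finset ℕ)) : Prop :=
  (G.IsAcyclic ∧ IsPivotLabelling lam) ∨ IsCycleCombinedLabelling lam

end TemporalGraph

/-! Both kinds of combined labelling have one shape: a core with a forest attached. Every vertex v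
off the core has a parent, and the edge to it carries two labels: f v, earlier than all core labels
and increasing towards the core, and g v, later than all core labels and decreasing towards the
core. So one climbs by f, crosses the core, and descends by g. Without f v, the vertex v stays in
its subtree until the core labels are over; without g v, the subtree of v can only be entered before
the core labels start. Either way v is cut off, in one direction, from every core vertex other than
its root. Sending vertices to their roots turns walks of the whole graph into walks of the core, so
labels that the core needs remain necessary (`IsCoreExtension.exists_not_treach`). For a tree the
core is the single edge {p, v'} with a single label. Otherwise it is the largest cycle; the cactus
property makes each vertex off it have at most one neighbour on it, so tree edges of the contraction
lift uniquely.

For the cycle, unroll it to the integer line, with edge k between k and k + 1. From a start a,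
suppose one can descend to e and ascend to e + c - 1 and no further: every residue is then covered
exactly once. Call the descent rigid if, on each edge, its crossing time is the only label between
the neighbouring crossing times. Erasing one of its labels then delays it by a full step, it stops
one edge early, and the vertex e becomes unreachable (`IsRigid.not_treach_cycleRel`). Ascents are
reflected descents. Explicit formulas give such descents and ascents, and every label of the
generator labelling lies on a rigid one (`IsGeneratorLabels.exists_time`).

With M = ⌈c/2⌉ the label count is at least M² + 1 for even c and m² + m + 1 for c = 2m + 1, and edge
0 alone carries M labels. The forest contributes two labels per vertex off the core. Finally, a
minimal temporally connected labelling has at most n³ labels, so the suprema over labellings are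
taken over bounded sets. -/

namespace TemporalGraph

/-! ### Time-respecting reachability -/

open SimpleGraph

/-- `TReach R u s v t`: from `u` one reaches `v` along steps `R x y a` with strictly increasing
times `a`, all of them at least `s` and smaller than `t`. -/
inductive TReach {α : Type*} (R : α → α → ℕ → Prop) (u : α) (s : ℕ) : α → ℕ → Prop
  | refl {t : ℕ} : s ≤ t → TReach R u s u t
  | step {v w : α} {a b t : ℕ} : TReach R u s v a → R v w b → a ≤ b → b < t → TReach R u s w t

namespace TReach

variable {α β : Type*} {R : α → α → ℕ → Prop} {R' : β → β → ℕ → Prop} {u v w : α} {s t a b : ℕ}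

theorem mono (h : TReach R u s v t) (hab : t ≤ a) : TReach R u s v a := by
  cases h with
  | refl h => exact .refl (h.trans hab)
  | step h hR h1 h2 => exact .step h hR h1 (by omega)

theorem trans (h : TReach R u s v t) (h' : TReach R v t w a) : TReach R u s w a := by
  induction h' with
  | refl ht => exact h.mono ht
  | step _ hR h1 h2 ih => exact .step ih hR h1 h2

theorem single (h : R u v a) : TReach R u a v (a + 1) :=
  .step (.refl le_rfl) h le_rfl (by omega)

theorem of_le (h : TReach R u s v t) (hab : a ≤ s) : TReach R u a v t :=
  (TReach.refl hab).trans h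

/-- Waiting is free, so steps whose endpoints `f` identifies may be dropped. This lets one map serve
both as a graph homomorphism and as a retraction onto the core. -/
theorem map (f : α → β) (hf : ∀ x y a, R x y a → f x = f y ∨ R' (f x) (f y) a)
    (h : TReach R u s v t) : TReach R' (f u) s (f v) t := by
  induction h with
  | refl ht => exact .refl ht
  | step _ hR h1 h2 ih =>
    rcases hf _ _ _ hR with h | h
    · rw [← h]; exact ih.mono (by omega)
    · exact .step ih h h1 h2

theorem imp {R' : α → α → ℕ → Prop} (hf : ∀ x y a, R x y a → R' x y a)
    (h : TReach R u s v t) : TReach R' u s v t :=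
  h.map id fun x y a hR => Or.inr (hf x y a hR)

/-- The tool for all unreachability proofs: `S t` is an upper bound for the set of positions
possible before time t. -/
theorem invariant (S : ℕ → α → Prop) (hu : S s u) (hmono : ∀ a b x, a ≤ b → S a x → S b x)
    (hstep : ∀ a x y, S a x → R x y a → S (a + 1) y) (h : TReach R u s v t) : S t v := by
  induction h with
  | refl ht => exact hmono _ _ _ ht hu
  | step _ hR h1 h2 ih => exact hmono _ _ _ h2 (hstep _ _ _ (hmono _ _ _ h1 ih) hR)

theorem window (hR : ∀ x y c, R x y c → a ≤ c ∧ c < b) (hab : a ≤ b) (h : TReach R u s v t) :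
    TReach R u a v b := by
  -- Clamping the arrival time into [a, b] makes the induction go through, including for trivial
  -- walks, whose bounds are arbitrary.
  suffices h' : TReach R u a v (max a (min t b)) from h'.mono (by omega)
  induction h with
  | refl ht => exact .refl (le_max_left _ _)
  | step _ hr h1 h2 ih =>
    obtain ⟨h3, h4⟩ := hR _ _ _ hr
    exact .step ih hr (by omega) (by omega)

end TReach

/-! ### Labellings as labelled steps -/

section Labelling

variable {V : Type*} {G : SimpleGraph V}

/-- `e` is an edge that carries the label `t`. -/
def HasLabel (lam : G.EdgeLabeling (Finset ℕ)) (e : Sym2 V) (t : ℕ) : Prop :=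
  ∃ h : e ∈ G.edgeSet, t ∈ lam ⟨e, h⟩

/-- The edge between `x` and `y` carries the label `t`. -/
def labelRel (lam : G.EdgeLabeling (Finset ℕ)) (x y : V) (t : ℕ) : Prop :=
  HasLabel lam s(x, y) t

theorem exists_treach_of_walk {lam : G.EdgeLabeling (Finset ℕ)} {u v : V} (p : G.Walk u v) :
    ∀ (ts : List ℕ) (s : ℕ), List.Forall₂ (HasLabel lam) p.edges ts →
      ts.Pairwise (· < ·) → (∀ t ∈ ts, s ≤ t) → ∃ t, TReach (labelRel lam) u s v t := by
  induction p with
  | nil => exact fun ts s _ _ _ => ⟨s, .refl le_rfl⟩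
  | @cons u w v h p ih =>
    intro ts s hf hp hs
    rw [Walk.edges_cons] at hf
    cases hf with
    | @cons _ t _ ts h1 h2 =>
      rw [List.pairwise_cons] at hp
      obtain ⟨t', ht'⟩ := ih ts (t + 1) h2 hp.2 fun x hx => hp.1 x hx
      have h1' : labelRel lam u w t := h1
      exact ⟨t', ((TReach.single h1').of_le (hs t (by simp))).trans ht'⟩

theorem exists_walk_of_treach {lam : G.EdgeLabeling (Finset ℕ)} {u v : V} {s t : ℕ}
    (h : TReach (labelRel lam) u s v t) : ∃ (p : G.Walk u v) (ts : List ℕ),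
      List.Forall₂ (HasLabel lam) p.edges ts ∧
      ts.Pairwise (· < ·) ∧ ∀ a ∈ ts, a < t := by
  induction h with
  | refl _ => exact ⟨.nil, [], by simp⟩
  | @step v w a b t _ hR h1 h2 ih =>
    obtain ⟨p, ts, hf, hp, ht⟩ := ih
    obtain ⟨hadj, hb⟩ := hR
    have hadj' : G.Adj v w := hadj
    refine ⟨p.concat hadj', ts ++ [b], ?_, ?_, ?_⟩
    · rw [Walk.edges_concat, List.concat_eq_append]
      exact List.rel_append hf (.cons ⟨hadj, hb⟩ .nil)
    · rw [List.pairwise_append]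
      refine ⟨hp, by simp, fun x hx y hy => ?_⟩
      have := ht x hx
      simp only [List.mem_singleton] at hy
      omega
    · intro x hx
      rcases List.mem_append.1 hx with hx | hx
      · have := ht x hx; omega
      · simp only [List.mem_singleton] at hx; omega

theorem reaches_iff {lam : G.EdgeLabeling (Finset ℕ)} {u v : V} :
    Reaches lam u v ↔ ∃ t, TReach (labelRel lam) u 0 v t := by
  constructor
  · rintro ⟨p, ts, hf, hp⟩
    exact exists_treach_of_walk p ts 0 hf hp fun _ _ => Nat.zero_le _
  · rintro ⟨t, ht⟩
    obtain ⟨p, ts, hf, hp, _⟩ := exists_walk_of_treach ht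
    exact ⟨p, ts, hf, hp⟩

theorem labelRel_removeLabel {lam : G.EdgeLabeling (Finset ℕ)} {e : G.edgeSet} {t₀ : ℕ} {x y : V}
    {t : ℕ} : labelRel (removeLabel lam e t₀) x y t ↔
      labelRel lam x y t ∧ ¬ (s(x, y) = (e : Sym2 V) ∧ t = t₀) := by
  classical
  have key : ∀ (f : G.edgeSet → Finset ℕ) (e' : G.edgeSet),
      t ∈ Function.update f e ((f e).erase t₀) e' ↔ t ∈ f e' ∧ ¬ (e' = e ∧ t = t₀) := by
    intro f e'
    by_cases he : e' = e
    · subst he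
      simp [and_comm]
    · simp [he]
  constructor
  · rintro ⟨h, ht⟩
    have := (key lam ⟨s(x, y), h⟩).1 ht
    exact ⟨⟨h, this.1⟩, fun h' => this.2 ⟨Subtype.ext h'.1, h'.2⟩⟩
  · rintro ⟨⟨h, ht⟩, hne⟩
    exact ⟨h, (key lam ⟨s(x, y), h⟩).2 ⟨ht, fun h' => hne ⟨congrArg Subtype.val h'.1, h'.2⟩⟩⟩

/-- The reachability graph here is complete, and only complete digraphs are isomorphic to it; so "up
to isomorphism" costs nothing, and minimality asks for one unreachable pair per erased label. -/
theorem IsTemporallyConnected.reachabilityEquivalent_iff {lam mu : G.EdgeLabeling (Finset ℕ)}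
    (h : IsTemporallyConnected lam) :
    ReachabilityEquivalent lam mu ↔ IsTemporallyConnected mu := by
  constructor
  · rintro ⟨φ⟩ u v
    have := φ.map_rel_iff.2 (h (φ.symm u) (φ.symm v))
    simpa using this
  · exact fun h' => ⟨⟨Equiv.refl V, fun {a b} => iff_of_true (h' _ _) (h a b)⟩⟩

theorem IsTemporallyConnected.isMinimal {lam : G.EdgeLabeling (Finset ℕ)}
    (h : IsTemporallyConnected lam)
    (hmin : ∀ x y t₀, labelRel lam x y t₀ → ∃ u v, ∀ t,
      ¬ TReach (fun a b t => labelRel lam a b t ∧ ¬ (s(a, b) = s(x, y) ∧ t = t₀)) u 0 v t) :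
    IsMinimal lam := by
  rintro ⟨e, he⟩ t₀ ht₀
  rw [h.reachabilityEquivalent_iff]
  induction e with
  | h x y =>
    intro hc
    obtain ⟨u, v, huv⟩ := hmin x y t₀ ⟨he, ht₀⟩
    obtain ⟨t, ht⟩ := reaches_iff.1 (hc u v)
    exact huv t (ht.imp fun a b t hab => labelRel_removeLabel.1 hab)

theorem isProper_iff {lam : G.EdgeLabeling (Finset ℕ)} : IsProper lam ↔
    ∀ x y z t, labelRel lam x y t → labelRel lam x z t → y = z := by
  constructor
  · rintro h x y z t ⟨h1, h1'⟩ ⟨h2, h2'⟩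
    by_contra hne
    have := h ⟨s(x, y), h1⟩ ⟨s(x, z), h2⟩
      (fun h => hne (Sym2.congr_right.1 (congrArg Subtype.val h))) ⟨x, by simp, by simp⟩
    exact Finset.disjoint_left.1 this h1' h2'
  · rintro h ⟨e, he⟩ ⟨f, hf⟩ hne ⟨v, hve, hvf⟩
    simp only at hve hvf
    obtain ⟨y, rfl⟩ := hve
    obtain ⟨z, rfl⟩ := hvf
    rw [Finset.disjoint_left]
    intro t h1 h2
    apply hne
    have := h v y z t ⟨he, h1⟩ ⟨hf, h2⟩
    subst this
    rfl

end Labelling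

end TemporalGraph

namespace TemporalGraph

open SimpleGraph

/-! ### Forests attached to a core -/

section Core

variable {V : Type*}

/-- The labelled steps `R` consist of the labelled steps `core` between vertices of `C` and of a
forest attached to `C`: every vertex `v` off `C` has a parent `up v`, and the edge between them
carries exactly the labels `f v` and `g v`. The labels `f v` come before the labels of the core and
increase towards `C`, the labels `g v` come after the labels of the core and decrease
towards `C`. -/
structure IsCoreExtension (R : V → V → ℕ → Prop) (C : Set V) (core : V → V → ℕ → Prop)
    (up : V → V) (dep f g : V → ℕ) (s₁ s₂ : ℕ) : Prop where
  rel_iff : ∀ x y t, R x y t ↔ (x ∉ C ∧ y = up x ∧ (t = f x ∨ t = g x)) ∨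
    (y ∉ C ∧ x = up y ∧ (t = f y ∨ t = g y)) ∨ core x y t
  core_symm : ∀ x y t, core x y t → core y x t
  core_left : ∀ x y t, core x y t → x ∈ C
  dep_lt : ∀ x, x ∉ C → dep (up x) < dep x
  f_lt : ∀ x, x ∉ C → up x ∉ C → f x < f (up x)
  g_lt : ∀ x, x ∉ C → up x ∉ C → g (up x) < g x
  f_inj : ∀ x y, x ∉ C → y ∉ C → f x = f y → x = y
  g_inj : ∀ x y, x ∉ C → y ∉ C → g x = g y → x = y
  f_lt_start : ∀ x, x ∉ C → f x < s₁
  start_le : ∀ x y t, core x y t → s₁ ≤ t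
  lt_end : ∀ x y t, core x y t → t < s₂
  end_le : ∀ x, x ∉ C → s₂ ≤ g x
  le_end : s₁ ≤ s₂

namespace IsCoreExtension

variable {R : V → V → ℕ → Prop} {C : Set V} {core : V → V → ℕ → Prop} {up : V → V}
  {dep f g : V → ℕ} {s₁ s₂ : ℕ}

theorem core_right (h : IsCoreExtension R C core up dep f g s₁ s₂) {x y : V} {t : ℕ}
    (hxy : core x y t) : y ∈ C :=
  h.core_left _ _ _ (h.core_symm _ _ _ hxy)

theorem f_lt_g (h : IsCoreExtension R C core up dep f g s₁ s₂) {x y : V} (hx : x ∉ C)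
    (hy : y ∉ C) : f x < g y := by
  have := h.f_lt_start x hx
  have := h.end_le y hy
  have := h.le_end
  omega

theorem rel_up_f (h : IsCoreExtension R C core up dep f g s₁ s₂) {x : V} (hx : x ∉ C) :
    R x (up x) (f x) :=
  (h.rel_iff _ _ _).2 (.inl ⟨hx, rfl, .inl rfl⟩)

theorem rel_up_g (h : IsCoreExtension R C core up dep f g s₁ s₂) {x : V} (hx : x ∉ C) :
    R (up x) x (g x) :=
  (h.rel_iff _ _ _).2 (.inr (.inl ⟨hx, rfl, .inr rfl⟩))

/-- The induction principle along the forest. -/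
theorem induction (h : IsCoreExtension R C core up dep f g s₁ s₂) {p : V → Prop}
    (hC : ∀ x ∈ C, p x) (hup : ∀ x, x ∉ C → p (up x) → p x) (x : V) : p x := by
  induction hn : dep x using Nat.strong_induction_on generalizing x with
  | _ n ih =>
    by_cases hx : x ∈ C
    · exact hC x hx
    · exact hup x hx (ih _ (hn ▸ h.dep_lt x hx) _ rfl)

/-- The root of x is the point where its chain of parents meets C. Only core steps can change it, so
it is a retraction that ignores the forest. -/
theorem exists_root (h : IsCoreExtension R C core up dep f g s₁ s₂) :
    ∃ ρ : V → V, (∀ x, ρ x ∈ C) ∧ (∀ x ∈ C, ρ x = x) ∧ ∀ x, x ∉ C → ρ (up x) = ρ x := by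
  classical
  -- Stopping in C makes surplus iterations harmless, and `dep x` iterations always suffice.
  let up' : V → V := fun x => if x ∈ C then x else up x
  have hfix : ∀ n, ∀ x ∈ C, up'^[n] x = x := by
    intro n x hx
    exact Function.iterate_fixed (by simp [up', hx]) n
  have hmem : ∀ n x, dep x ≤ n → up'^[n] x ∈ C := by
    intro n
    induction n with
    | zero =>
      intro x hx
      by_contra hC
      have := h.dep_lt x hC
      omega
    | succ n ih =>
      intro x hx
      by_cases hC : x ∈ C
      · rw [hfix _ _ hC]; exact hC
      · rw [Function.iterate_succ_apply]
        apply ih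
        have := h.dep_lt x hC
        simp only [up', hC, if_false]
        omega
  have hstab : ∀ m n x, dep x ≤ n → up'^[m + n] x = up'^[n] x := by
    intro m n x hx
    rw [Function.iterate_add_apply]
    exact hfix _ _ (hmem n x hx)
  refine ⟨fun x => up'^[dep x] x, fun x => hmem _ _ le_rfl, fun x hx => hfix _ _ hx, ?_⟩
  intro x hx
  have hlt := h.dep_lt x hx
  obtain ⟨k, hk⟩ : ∃ k, dep x = k + dep (up x) + 1 := ⟨dep x - dep (up x) - 1, by omega⟩
  simp only
  rw [hk, Function.iterate_succ_apply]
  have : up' x = up x := by simp [up', hx]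
  rw [this, hstab _ _ _ le_rfl]

/-- The subtree hanging at `v`. -/
def Desc (C : Set V) (up : V → V) (v : V) (x : V) : Prop :=
  ∃ l : ℕ, up^[l] x = v ∧ ∀ k ≤ l, up^[k] x ∉ C

theorem desc_iff {v x : V} (hv : v ∉ C) :
    Desc C up v x ↔ x ∉ C ∧ (x = v ∨ Desc C up v (up x)) := by
  constructor
  · rintro ⟨l, hl, hC⟩
    refine ⟨hC 0 (Nat.zero_le _), ?_⟩
    cases l with
    | zero => exact .inl hl
    | succ l =>
      refine .inr ⟨l, hl, fun k hk => ?_⟩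
      have := hC (k + 1) (by omega)
      rwa [Function.iterate_succ_apply] at this
  · rintro ⟨hx, rfl | ⟨l, hl, hC⟩⟩
    · exact ⟨0, rfl, fun k hk => by simpa [Nat.le_zero.1 hk] using hx⟩
    · refine ⟨l + 1, hl, fun k hk => ?_⟩
      cases k with
      | zero => exact hx
      | succ k =>
        rw [Function.iterate_succ_apply]
        exact hC k (by omega)

theorem exists_treach (h : IsCoreExtension R C core up dep f g s₁ s₂)
    (hcore : ∀ x ∈ C, ∀ y ∈ C, ∃ t, TReach core x 0 y t) (u v : V) : ∃ t, TReach R u 0 v t := by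
  obtain ⟨ρ, hρC, hρ, hup⟩ := h.exists_root
  -- The departure time is `f x` off the core and `s₁` on it, so that each induction step can
  -- prepend an earlier edge.
  have h1 : ∀ x, (x ∉ C → TReach R x (f x) (ρ x) s₁) ∧ (x ∈ C → TReach R x s₁ (ρ x) s₁) := by
    refine fun x => h.induction (p := fun x => (x ∉ C → TReach R x (f x) (ρ x) s₁) ∧
      (x ∈ C → TReach R x s₁ (ρ x) s₁)) ?_ ?_ x
    · intro x hx
      refine ⟨fun h' => absurd hx h', fun _ => ?_⟩
      rw [hρ x hx]; exact .refl le_rfl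
    · rintro x hx ⟨ih1, ih2⟩
      refine ⟨fun _ => ?_, fun h' => absurd h' hx⟩
      rw [← hup x hx]
      refine (TReach.single (h.rel_up_f hx)).trans ?_
      by_cases hxC : up x ∈ C
      · exact (ih2 hxC).of_le (h.f_lt_start x hx)
      · exact (ih1 hxC).of_le (h.f_lt x hx hxC)
  have h2 : ∀ x, (x ∉ C → TReach R (ρ x) s₂ x (g x + 1)) ∧ (x ∈ C → TReach R (ρ x) s₂ x s₂) := by
    refine fun x => h.induction (p := fun x => (x ∉ C → TReach R (ρ x) s₂ x (g x + 1)) ∧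
      (x ∈ C → TReach R (ρ x) s₂ x s₂)) ?_ ?_ x
    · intro x hx
      refine ⟨fun h' => absurd hx h', fun _ => ?_⟩
      rw [hρ x hx]; exact .refl le_rfl
    · rintro x hx ⟨ih1, ih2⟩
      refine ⟨fun _ => ?_, fun h' => absurd h' hx⟩
      rw [← hup x hx]
      by_cases hxC : up x ∈ C
      · exact .step (ih2 hxC) (h.rel_up_g hx) (h.end_le x hx) (by omega)
      · exact .step (ih1 hxC) (h.rel_up_g hx) (h.g_lt x hx hxC) (by omega)
  have h1' : TReach R u 0 (ρ u) s₁ := by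
    by_cases hu : u ∈ C
    · exact ((h1 u).2 hu).of_le (Nat.zero_le _)
    · exact ((h1 u).1 hu).of_le (Nat.zero_le _)
  obtain ⟨t, ht⟩ := hcore _ (hρC u) _ (hρC v)
  have h3 : TReach R (ρ u) s₁ (ρ v) s₂ :=
    (ht.window (fun x y c hc => ⟨h.start_le x y c hc, h.lt_end x y c hc⟩) h.le_end).imp
      fun x y c hc => (h.rel_iff _ _ _).2 (.inr (.inr hc))
  by_cases hv : v ∈ C
  · exact ⟨_, (h1'.trans h3).trans ((h2 v).2 hv)⟩
  · exact ⟨_, (h1'.trans h3).trans ((h2 v).1 hv)⟩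

/-- The labels f, the core labels and the labels g occupy disjoint time ranges; f and g are
injective, so a repeated forest label means the same edge. -/
theorem rel_unique (h : IsCoreExtension R C core up dep f g s₁ s₂)
    (hcore : ∀ x y z t, core x y t → core x z t → y = z) {x y z : V} {t : ℕ}
    (hxy : R x y t) (hxz : R x z t) : y = z := by
  have aux : ∀ a b, a ∉ C → b ∉ C → (t = f a ∨ t = g a) → (t = f b ∨ t = g b) → a = b := by
    intro a b ha hb hta htb
    have h1 := h.f_lt_g ha hb
    have h2 := h.f_lt_g hb ha
    rcases hta with hta | hta <;> rcases htb with htb | htb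
    · exact h.f_inj a b ha hb (by omega)
    · omega
    · omega
    · exact h.g_inj a b ha hb (by omega)
  have aux' : ∀ a p q, a ∉ C → (t = f a ∨ t = g a) → ¬ core p q t := by
    intro a p q ha hta hc
    have h1 := h.f_lt_start a ha
    have h2 := h.end_le a ha
    have h3 := h.start_le _ _ _ hc
    have h4 := h.lt_end _ _ _ hc
    omega
  rcases (h.rel_iff _ _ _).1 hxy with ⟨hx, rfl, h1⟩ | ⟨hy, rfl, h1⟩ | h1 <;>
  rcases (h.rel_iff _ _ _).1 hxz with ⟨hx', rfl, h2⟩ | ⟨hy', hxz, h2⟩ | h2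
  · rfl
  · have := aux _ _ hx hy' h1 h2
    subst this
    have := h.dep_lt x hx
    rw [← hxz] at this
    omega
  · exact absurd h2 (aux' _ _ _ hx h1)
  · have := aux _ _ hy hx' h1 h2
    have h3 := h.dep_lt y hy
    rw [← this] at h3
    omega
  · exact aux _ _ hy hy' h1 h2
  · exact absurd h2 (aux' _ _ _ hy h1)
  · exact absurd h1 (aux' _ _ _ hx' h2)
  · exact absurd h1 (aux' _ _ _ hy' h2)
  · exact hcore _ _ _ _ h1 h2

/-- Up to time `g v` the subtree of v cannot be left. Core labels are all smaller than `g v`, so no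
core step is ever available and the root never changes. -/
theorem not_treach_of_erase_f (h : IsCoreExtension R C core up dep f g s₁ s₂)
    {ρ : V → V} (hup : ∀ x, x ∉ C → ρ (up x) = ρ x) {v r : V}
    (hv : v ∉ C) (hr : ρ r ≠ ρ v) (t : ℕ) :
    ¬ TReach (fun a b t => R a b t ∧ ¬ (s(a, b) = s(v, up v) ∧ t = f v)) v 0 r t := by
  intro ht
  suffices h' : (t ≤ g v → Desc C up v r) ∧ ρ r = ρ v from hr h'.2
  refine ht.invariant (fun t x => (t ≤ g v → Desc C up v x) ∧ ρ x = ρ v)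
    ⟨fun _ => (desc_iff hv).2 ⟨hv, .inl rfl⟩, rfl⟩ (fun a b x hab hx =>
      ⟨fun hb => hx.1 (hab.trans hb), hx.2⟩) ?_
  rintro a x y ⟨hx1, hx2⟩ ⟨hR, hne⟩
  rcases (h.rel_iff _ _ _).1 hR with ⟨hx, rfl, hl⟩ | ⟨hy, rfl, hl⟩ | hc
  · refine ⟨fun ha => ?_, by rw [hup x hx, hx2]⟩
    have hd := hx1 (by omega)
    rw [desc_iff hv] at hd
    rcases hd.2 with rfl | hd
    · rcases hl with rfl | rfl
      · exact absurd ⟨rfl, rfl⟩ hne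
      · omega
    · exact hd
  · refine ⟨fun ha => ?_, by rw [← hup y hy, hx2]⟩
    exact (desc_iff hv).2 ⟨hy, .inr (hx1 (by omega))⟩
  · exfalso
    have h1 := h.lt_end _ _ _ hc
    have h2 := h.end_le v hv
    exact ((desc_iff hv).1 (hx1 (by omega))).1 (h.core_left _ _ _ hc)

/-- The subtree of v could only be entered at time `f v` from its parent. At that time no core label
has occurred yet, so the walk still has the root of r, which differs from that of v. -/
theorem not_treach_of_erase_g (h : IsCoreExtension R C core up dep f g s₁ s₂)
    {ρ : V → V} (hup : ∀ x, x ∉ C → ρ (up x) = ρ x) {v r : V}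
    (hv : v ∉ C) (hrC : r ∈ C) (hr : ρ r ≠ ρ v) (t : ℕ) :
    ¬ TReach (fun a b t => R a b t ∧ ¬ (s(a, b) = s(v, up v) ∧ t = g v)) r 0 v t := by
  intro ht
  suffices h' : ¬ Desc C up v v ∧ (t ≤ f v → ρ v = ρ r) from
    h'.1 ((desc_iff hv).2 ⟨hv, .inl rfl⟩)
  refine ht.invariant (fun t x => ¬ Desc C up v x ∧ (t ≤ f v → ρ x = ρ r))
    ⟨fun hd => ((desc_iff hv).1 hd).1 hrC, fun _ => rfl⟩ (fun a b x hab hx =>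
      ⟨hx.1, fun hb => hx.2 (hab.trans hb)⟩) ?_
  rintro a x y ⟨hx1, hx2⟩ ⟨hR, hne⟩
  rcases (h.rel_iff _ _ _).1 hR with ⟨hx, rfl, hl⟩ | ⟨hy, rfl, hl⟩ | hc
  · refine ⟨fun hd => hx1 ((desc_iff hv).2 ⟨hx, .inr hd⟩), fun ha => ?_⟩
    rw [hup x hx, hx2 (by omega)]
  · refine ⟨fun hd => ?_, fun ha => by rw [← hup y hy, hx2 (by omega)]⟩
    rcases ((desc_iff hv).1 hd).2 with rfl | hd
    · rcases hl with rfl | rfl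
      · exact hr ((hx2 le_rfl).symm.trans (hup y hy))
      · exact hne ⟨Sym2.eq_swap, rfl⟩
    · exact hx1 hd
  · have hy := h.core_right hc
    refine ⟨fun hd => ((desc_iff hv).1 hd).1 hy, fun ha => ?_⟩
    have h1 := h.start_le _ _ _ hc
    have h2 := h.f_lt_start v hv
    omega

/-- A forest label of v separates v from a core vertex other than its root, which exists because C
is nontrivial. For a core label, the root map projects any walk to a core walk with the same label
erased. -/
theorem exists_not_treach (h : IsCoreExtension R C core up dep f g s₁ s₂)
    (hC : C.Nontrivial)
    (hcore : ∀ x y t₀, core x y t₀ → ∃ u ∈ C, ∃ v ∈ C, ∀ t,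
      ¬ TReach (fun a b t => core a b t ∧ ¬ (s(a, b) = s(x, y) ∧ t = t₀)) u 0 v t)
    (x y : V) (t₀ : ℕ) (hR : R x y t₀) : ∃ u v, ∀ t,
      ¬ TReach (fun a b t => R a b t ∧ ¬ (s(a, b) = s(x, y) ∧ t = t₀)) u 0 v t := by
  obtain ⟨ρ, hρC, hρ, hup⟩ := h.exists_root
  have key : ∀ v, v ∉ C → (t₀ = f v ∨ t₀ = g v) → ∃ u w, ∀ t,
      ¬ TReach (fun a b t => R a b t ∧ ¬ (s(a, b) = s(v, up v) ∧ t = t₀)) u 0 w t := by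
    intro v hv hl
    obtain ⟨r, hrC, hr⟩ := hC.exists_ne (ρ v)
    have hr' : ρ r ≠ ρ v := by rwa [hρ r hrC]
    rcases hl with rfl | rfl
    · exact ⟨v, r, h.not_treach_of_erase_f hup hv hr'⟩
    · exact ⟨r, v, h.not_treach_of_erase_g hup hv hrC hr'⟩
  rcases (h.rel_iff _ _ _).1 hR with ⟨hx, rfl, hl⟩ | ⟨hy, rfl, hl⟩ | hc
  · exact key x hx hl
  · rw [Sym2.eq_swap]; exact key y hy hl
  · obtain ⟨u, hu, v, hv, huv⟩ := hcore x y t₀ hc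
    refine ⟨u, v, fun t ht => huv t ?_⟩
    have := ht.map (R' := fun a b t => core a b t ∧ ¬ (s(a, b) = s(x, y) ∧ t = t₀)) ρ ?_
    · rwa [hρ u hu, hρ v hv] at this
    · rintro a b c ⟨hab, hne⟩
      rcases (h.rel_iff _ _ _).1 hab with ⟨ha, rfl, _⟩ | ⟨hb, rfl, _⟩ | hc'
      · exact .inl (hup a ha).symm
      · exact .inl (hup b hb)
      · rw [hρ a (h.core_left _ _ _ hc'), hρ b (h.core_right hc')]
        exact .inr ⟨hc', hne⟩

end IsCoreExtension

end Core

/-! ### Lower bounds for cost and temporality -/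

section Cost

variable {V : Type*} {G : SimpleGraph V}

/-- Each member of a family of distinct edges carries at least the labels of the given sets. -/
theorem sum_card_le_temporalCost [Fintype V] {lam : G.EdgeLabeling (Finset ℕ)} {ι : Type*}
    (s : Finset ι) (e : ι → Sym2 V) (A : ι → Finset ℕ) (he : Set.InjOn e s)
    (hA : ∀ i ∈ s, ∀ t ∈ A i, HasLabel lam (e i) t) : ∑ i ∈ s, (A i).card ≤ temporalCost lam := by
  classical
  unfold temporalCost
  let B : Sym2 V → ℕ := fun e => if h : e ∈ G.edgeSet then (lam ⟨e, h⟩).card else 0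
  have h1 : ∀ i ∈ s, (A i).card ≤ B (e i) := by
    intro i hi
    rcases (A i).eq_empty_or_nonempty with h0 | ⟨t, ht⟩
    · simp [h0]
    · obtain ⟨h, _⟩ := hA i hi t ht
      simp only [B, h, dif_pos]
      refine Finset.card_le_card fun t ht => ?_
      exact (hA i hi t ht).2
  calc ∑ i ∈ s, (A i).card ≤ ∑ i ∈ s, B (e i) := Finset.sum_le_sum h1
    _ = ∑ e' ∈ s.image e, B e' := (Finset.sum_image he).symm
    _ ≤ ∑ e' : Sym2 V, B e' := Finset.sum_le_sum_of_subset (Finset.subset_univ _)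
    _ = ∑ e' ∈ Finset.univ.filter (· ∈ G.edgeSet), B e' := by
        rw [Finset.sum_filter]
        refine Finset.sum_congr rfl fun e' _ => ?_
        by_cases h : e' ∈ G.edgeSet <;> simp [B, h]
    _ = ∑ e' : G.edgeSet, B e' := by
        rw [Finset.sum_subtype (p := (· ∈ G.edgeSet))]
        simp
    _ = _ := Finset.sum_congr (by ext; simp) fun e' _ => by simp [B]

theorem card_le_temporality [Fintype V] {lam : G.EdgeLabeling (Finset ℕ)} {e : Sym2 V}
    (he : e ∈ G.edgeSet) {A : Finset ℕ} (hA : ∀ t ∈ A, HasLabel lam e t) :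
    A.card ≤ temporality lam := by
  classical
  unfold temporality
  have h1 : A.card ≤ (lam ⟨e, he⟩).card := Finset.card_le_card fun t ht => (hA t ht).2
  exact h1.trans (Finset.le_sup (f := fun e : G.edgeSet => (lam e).card) (Finset.mem_univ _))

end Cost

end TemporalGraph

namespace TemporalGraph

/-! ### Cycles unrolled to the integer line -/

section Cycle

/-- The labelled steps on the integer line where the edge from `k` to `k + 1` has the labels
`A k`. -/
def lineRel (A : ℤ → ℕ → Prop) (x y : ℤ) (t : ℕ) : Prop :=
  (A x t ∧ y = x + 1) ∨ (A y t ∧ x = y + 1)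

/-- The image of `lineRel A` under `w`. -/
def cycleRel {V : Type*} (w : ℤ → V) (A : ℤ → ℕ → Prop) (x y : V) (t : ℕ) : Prop :=
  ∃ k, A k t ∧ ((x = w k ∧ y = w (k + 1)) ∨ (x = w (k + 1) ∧ y = w k))

theorem cycleRel_symm {V : Type*} {w : ℤ → V} {A : ℤ → ℕ → Prop} {x y : V} {t : ℕ}
    (h : cycleRel w A x y t) : cycleRel w A y x t := by
  obtain ⟨k, hk, h | h⟩ := h
  · exact ⟨k, hk, .inr ⟨h.2, h.1⟩⟩
  · exact ⟨k, hk, .inl ⟨h.2, h.1⟩⟩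

theorem lineRel_neg {A : ℤ → ℕ → Prop} {x y : ℤ} {t : ℕ} (h : lineRel A x y t) :
    lineRel (fun k => A (-k)) (1 - x) (1 - y) t := by
  rcases h with ⟨h, rfl⟩ | ⟨h, rfl⟩
  · right
    refine ⟨?_, by ring⟩
    convert h using 1
    ring
  · left
    refine ⟨?_, by ring⟩
    convert h using 1
    ring

theorem cycleRel_of_lineRel {V : Type*} (w : ℤ → V) {A : ℤ → ℕ → Prop} {x y : ℤ} {t : ℕ}
    (h : lineRel A x y t) : cycleRel w A (w x) (w y) t := by
  rcases h with ⟨h, rfl⟩ | ⟨h, rfl⟩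
  · exact ⟨x, h, .inl ⟨rfl, rfl⟩⟩
  · exact ⟨y, h, .inr ⟨rfl, rfl⟩⟩

/-- The reflection x ↦ 1 - x of the vertices sends edge k to edge -k, which turns ascents into
descents. -/
theorem cycleRel_reflect {V : Type*} {w : ℤ → V} {A : ℤ → ℕ → Prop} :
    cycleRel (fun k => w (1 - k)) (fun k => A (-k)) = cycleRel w A := by
  have key : ∀ (w : ℤ → V) (A : ℤ → ℕ → Prop) x y t, cycleRel w A x y t →
      cycleRel (fun k => w (1 - k)) (fun k => A (-k)) x y t := by
    rintro w A x y t ⟨k, hk, h⟩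
    refine ⟨-k, by simpa using hk, ?_⟩
    have h1 : 1 - -k = k + 1 := by ring
    have h2 : 1 - (-k + 1) = k := by ring
    simp only [h1, h2]
    exact h.symm
  funext x y t
  refine propext ⟨fun h => ?_, key w A x y t⟩
  simpa using key _ _ _ _ _ h

/-- A time-respecting path on the line descends from `a` to `e`, using the edge `x` at
time `τ x`. -/
def IsDescent (A : ℤ → ℕ → Prop) (a e : ℤ) (τ : ℤ → ℕ) : Prop :=
  ∀ x, e ≤ x → x < a → A x (τ x) ∧ (x + 1 < a → τ (x + 1) < τ x)

/-- Starting in `a`, one cannot descend below `e`, and one crosses the edge `x` not before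
time `τ x`. -/
def IsBlocked (A : ℤ → ℕ → Prop) (a e : ℤ) (τ : ℤ → ℕ) : Prop :=
  e ≤ a ∧ (∀ x t, e ≤ x → x < a → A x t → (x + 1 < a → τ (x + 1) < t) → τ x ≤ t) ∧
  (∀ x, e ≤ x → x + 1 < a → τ (x + 1) ≤ τ x) ∧
  (∀ t, A (e - 1) t → (e < a → τ e < t) → False)

/-- The time `τ x` is the only label of the edge `x` between the times `τ (x + 1)`
and `τ (x - 1)`. -/
def IsRigid (A : ℤ → ℕ → Prop) (a e : ℤ) (τ : ℤ → ℕ) : Prop :=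
  (∀ x t, e ≤ x → x < a → A x t → (x + 1 < a → τ (x + 1) < t) →
    t = τ x ∨ (e < x ∧ τ (x - 1) ≤ t)) ∧
  (∀ x, e ≤ x → x + 1 < a → τ (x + 1) < τ x)

variable {A : ℤ → ℕ → Prop} {a b e e' : ℤ} {τ τ' : ℤ → ℕ} {s t : ℕ}

theorem IsBlocked.le (h : IsBlocked A a e τ) (hr : TReach (lineRel A) a s b t) : e ≤ b := by
  obtain ⟨hea, h1, h2, h3⟩ := h
  suffices h' : e ≤ b ∧ (b < a → τ b < t) from h'.1
  -- A vertex x < a is entered from above over the edge x, so it is not occupied before time τ x has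
  -- passed.
  refine hr.invariant (fun t x => e ≤ x ∧ (x < a → τ x < t)) ⟨hea, by omega⟩
    (fun p q x hpq hx => ⟨hx.1, fun h => (hx.2 h).trans_le hpq⟩) ?_
  rintro t x y ⟨hx, hx'⟩ (⟨hA, rfl⟩ | ⟨hA, rfl⟩)
  · refine ⟨by omega, fun h => ?_⟩
    have := h2 x hx h
    have := hx' (by omega)
    omega
  · rcases hx.lt_or_eq with hlt | heq
    · refine ⟨by omega, fun hy => ?_⟩
      have := h1 y t (by omega) hy hA hx'
      omega
    · subst heq
      exact (h3 t (by simpa using hA) hx').elim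

/-- Without τ d, the next usable label on edge d is at least τ (d - 1). By rigidity the delay
persists: each later edge x is crossed no earlier than τ (x - 1), and edge e has no label left for
the delayed walk. -/
theorem IsRigid.isBlocked (h : IsRigid A a e τ) {d : ℤ} (hed : e ≤ d) (hda : d < a)
    {A' : ℤ → ℕ → Prop} (hA' : ∀ x t, A' x t → A x t) (hd : ¬ A' d (τ d)) :
    IsBlocked A' a (e + 1) fun x => if d < x then τ x else τ (x - 1) := by
  obtain ⟨h1, h2⟩ := h
  have h2' : ∀ x, e < x → x < a → τ x < τ (x - 1) := fun x hx hxa => by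
    have := h2 (x - 1) (by omega) (by omega)
    simpa using this
  refine ⟨by omega, ?_, ?_, ?_⟩
  · intro x t hx hxa hA hlt
    have h3 := h1 x t (by omega) hxa (hA' _ _ hA)
    have h4 := h2' x (by omega) hxa
    rcases lt_trichotomy d x with hdx | rfl | hdx
    · simp only [hdx, if_true, show d < x + 1 by omega] at hlt ⊢
      rcases h3 hlt with h | h <;> omega
    · simp only [lt_irrefl, if_false, show d < d + 1 by omega, if_true] at hlt ⊢
      rcases h3 hlt with rfl | h
      · exact absurd hA hd
      · exact h.2
    · simp only [show ¬ d < x by omega, if_false, show ¬ d < x + 1 by omega] at hlt ⊢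
      have h5 := hlt (by omega)
      simp only [add_sub_cancel_right] at h5
      have h6 := h2 x (by omega) (by omega)
      rcases h3 (by omega) with h | h <;> omega
  · intro x hx hxa
    rcases lt_trichotomy d x with hdx | rfl | hdx
    · simp only [hdx, if_true, show d < x + 1 by omega]
      exact (h2 x (by omega) hxa).le
    · simp only [lt_irrefl, if_false, show d < d + 1 by omega, if_true]
      have := h2 d (by omega) hxa
      have := h2' d (by omega) hda
      omega
    · simp only [show ¬ d < x by omega, if_false]
      have := h2' x (by omega) (by omega)
      split_ifs
      · have := h2 x (by omega) hxa
        omega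
      · simp only [add_sub_cancel_right]
        omega
  · intro t hA hlt
    rw [add_sub_cancel_right] at hA
    have h3 := h1 e t le_rfl (by omega) (hA' _ _ hA)
    by_cases hde : d < e + 1
    · have : d = e := by omega
      subst this
      simp only [hde, if_true] at hlt
      rcases h3 hlt with rfl | h
      · exact hd hA
      · omega
    · simp only [hde, if_false, add_sub_cancel_right] at hlt
      have h5 := hlt (by omega)
      have h6 := h2 e le_rfl (by omega)
      rcases h3 (by omega) with h | h <;> omega

theorem IsDescent.exists_treach (h : IsDescent A a e τ) (heb : e ≤ b) (hba : b ≤ a) :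
    ∃ t, TReach (lineRel A) a 0 b t := by
  suffices key : ∀ n : ℕ, ∀ b, e ≤ b → b < a → a - b = n → TReach (lineRel A) a 0 b (τ b + 1) by
    rcases hba.lt_or_eq with hlt | rfl
    · exact ⟨_, key (a - b).toNat b heb hlt (by omega)⟩
    · exact ⟨0, .refl le_rfl⟩
  intro n
  induction n with
  | zero => intro b _ _ _; omega
  | succ n ih =>
    intro b hb hba hn
    have hstep : lineRel A (b + 1) b (τ b) := .inr ⟨(h b hb hba).1, rfl⟩
    by_cases hab : b + 1 < a
    · exact .step (ih (b + 1) (by omega) hab (by omega)) hstep ((h b hb hba).2 hab) (by omega)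
    · obtain rfl : a = b + 1 := by omega
      exact .step (.refl (Nat.zero_le _)) hstep le_rfl (by omega)

variable {V : Type*} {w : ℤ → V} {c : ℕ}

/-- Path lifting along ℤ → ℤ/c: a periodic labelling lets each step on the cycle be repeated on the
line. -/
theorem exists_lift_treach (hw : ∀ x y, w x = w y ↔ (c : ℤ) ∣ x - y)
    (hA : ∀ x y t, (c : ℤ) ∣ x - y → A x t → A y t) {v : V}
    (h : TReach (cycleRel w A) (w a) s v t) : ∃ b, v = w b ∧ TReach (lineRel A) a s b t := by
  induction h with
  | refl ht => exact ⟨a, rfl, .refl ht⟩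
  | step _ hR h1 h2 ih =>
    obtain ⟨b, rfl, hb⟩ := ih
    obtain ⟨k, hk, ⟨h3, h4⟩ | ⟨h3, h4⟩⟩ := hR
    · rw [hw] at h3
      refine ⟨b + 1, ?_, .step hb (.inl ⟨hA k b _ ((dvd_sub_comm).1 h3) hk, rfl⟩) h1 h2⟩
      rw [h4, hw, add_sub_add_right_eq_sub]
      exact dvd_sub_comm.1 h3
    · rw [hw] at h3
      have h3' : (c : ℤ) ∣ k - (b - 1) := by
        rw [dvd_sub_comm, show b - 1 - k = b - (k + 1) by ring]
        exact h3
      refine ⟨b - 1, ?_, .step hb (.inr ⟨hA k _ _ h3' hk, by ring⟩) h1 h2⟩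
      rw [h4, hw]
      exact h3'

/-- After the erasure a lifted walk stays in [e + 1, e + c - 1]: the lower bound is the delayed
descent, the upper bound the blocked ascent. No integer there is congruent to e. -/
theorem IsRigid.not_treach_cycleRel (hw : ∀ x y, w x = w y ↔ (c : ℤ) ∣ x - y)
    (hA : ∀ x y t, (c : ℤ) ∣ x - y → A x t → A y t) (h : IsRigid A a e τ)
    (h' : IsBlocked (fun k => A (-k)) (1 - a) e' τ') (hsum : e + c = 2 - e') {d : ℤ} (hed : e ≤ d)
    (hda : d < a) (t : ℕ) :
    ¬ TReach (fun x y t => cycleRel w A x y t ∧ ¬ (s(x, y) = s(w d, w (d + 1)) ∧ t = τ d))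
      (w a) 0 (w e) t := by
  intro ht
  -- The label disappears from all lifts of the edge d.
  let A' : ℤ → ℕ → Prop := fun x t => A x t ∧ ¬ ((c : ℤ) ∣ x - d ∧ t = τ d)
  have h1 : TReach (cycleRel w A') (w a) 0 (w e) t := by
    refine ht.imp ?_
    rintro x y t ⟨⟨k, hk, hxy⟩, hne⟩
    refine ⟨k, ⟨hk, fun hkd => hne ⟨?_, hkd.2⟩⟩, hxy⟩
    have e1 : w k = w d := (hw _ _).2 hkd.1
    have e2 : w (k + 1) = w (d + 1) := (hw _ _).2 (by simpa using hkd.1)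
    rcases hxy with ⟨rfl, rfl⟩ | ⟨rfl, rfl⟩
    · rw [e1, e2]
    · rw [e1, e2, Sym2.eq_swap]
  obtain ⟨b, hb, hr⟩ := exists_lift_treach hw (fun x y t hxy hx => by
    refine ⟨hA x y t hxy hx.1, fun hy => hx.2 ⟨?_, hy.2⟩⟩
    have := dvd_add hxy hy.1
    simpa using this) h1
  have h2 : e + 1 ≤ b :=
    (h.isBlocked hed hda (A' := A') (fun _ _ hx => hx.1) fun hx => hx.2 (by simp)).le hr
  have h3 : e' ≤ 1 - b := h'.le
    (hr.map (R' := lineRel fun k => A (-k)) (fun x => 1 - x) fun x y t hxy =>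
      .inr (lineRel_neg (hxy.imp (fun h => ⟨h.1.1, h.2⟩) fun h => ⟨h.1.1, h.2⟩)))
  rw [hw, dvd_sub_comm] at hb
  have := Int.le_of_dvd (by omega) hb
  omega

theorem IsDescent.exists_treach_cycleRel (hw : ∀ x y, w x = w y ↔ (c : ℤ) ∣ x - y) (hc : 0 < c)
    (h : IsDescent A a e τ) (h' : IsDescent (fun k => A (-k)) (1 - a) e' τ')
    (hsum : e + c ≤ 2 - e') (b : ℤ) : ∃ t, TReach (cycleRel w A) (w a) 0 (w b) t := by
  -- Take the representative of b in (a - c, a]. If it lies below e, adding c puts it within reach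
  -- of the ascent.
  have hmod : w b = w (a - (a - b) % c) := by
    rw [hw]
    have := Int.emod_add_mul_ediv (a - b) c
    exact ⟨-((a - b) / c), by linarith⟩
  have h0 := Int.emod_nonneg (a - b) (show (c : ℤ) ≠ 0 by omega)
  have hlt := Int.emod_lt_of_pos (a - b) (show (0 : ℤ) < c by omega)
  rw [hmod]
  generalize (a - b) % c = k at *
  by_cases hk : e ≤ a - k
  · obtain ⟨t, ht⟩ := h.exists_treach hk (by omega)
    exact ⟨t, ht.map w fun x y t hxy => .inr (cycleRel_of_lineRel w hxy)⟩
  · have h2 : w (a - k) = w (a - k + c) := by rw [hw]; exact ⟨-1, by ring⟩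
    rw [h2]
    obtain ⟨t, ht⟩ := h'.exists_treach (b := 1 - (a - k + c)) (by omega) (by omega)
    have := ht.map (R' := cycleRel w A) (fun x => w (1 - x)) fun x y t hxy => .inr (by
      rw [← cycleRel_reflect]
      exact cycleRel_of_lineRel (fun x => w (1 - x)) hxy)
    refine ⟨t, ?_⟩
    simpa using this

end Cycle

end TemporalGraph

namespace TemporalGraph

/-! ### Explicit descents and ascents for the generator labelling -/

section Certificates

/-- The labels of the clockwise edge of round `r > 0` in the generator labelling of a cycle of size
`2 * M - ε`. -/
def cwLabel (M ε r t : ℤ) : Prop :=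
  ((t - r - 1 + ε) % 2 = 0 ∧ t ≤ r - 1 - ε) ∨ ((t - r - 1) % 4 = 0 ∧ r + 1 ≤ t ∧ t ≤ 2 * M - 1 - r) ∨
    (ε = 0 ∧ r = M ∧ t = M + 1)

/-- The labels of the counter-clockwise edge of round `r > 0` in the generator labelling of a cycle
of size `2 * M - ε`. -/
def ccwLabel (M r t : ℤ) : Prop :=
  ((t - r - 1) % 2 = 0 ∧ t ≤ r - 1) ∨ ((t - r - 3) % 4 = 0 ∧ r + 3 ≤ t ∧ t ≤ 2 * M - 1 - r)

/-- The labels of the generator labelling of a cycle of size `c = 2 * M - ε` on the edge at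
position `x`, for `-c < x < c`. -/
def posLabel (M ε x t : ℤ) : Prop :=
  1 ≤ t ∧ ((x = 0 ∧ t % 2 = 1 ∧ t ≤ 2 * M - 1) ∨
    (0 < x ∧ x ≤ M - ε ∧ cwLabel M ε x t) ∨
    (-M < x ∧ x < 0 ∧ ccwLabel M (-x) t) ∨
    (M - ε < x ∧ ccwLabel M (2 * M - ε - x) t) ∨
    (x ≤ -M ∧ cwLabel M ε (x + (2 * M - ε)) t))

theorem posLabel_of {M ε x t : ℤ} (ht : 1 ≤ t) (h0 : x = 0 → t % 2 = 1 ∧ t ≤ 2 * M - 1)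
    (h1 : 0 < x → x ≤ M - ε → cwLabel M ε x t) (h2 : -M < x → x < 0 → ccwLabel M (-x) t)
    (h3 : M - ε < x → ccwLabel M (2 * M - ε - x) t)
    (h4 : x ≤ -M → cwLabel M ε (x + (2 * M - ε)) t) : posLabel M ε x t := by
  refine ⟨ht, ?_⟩
  rcases lt_trichotomy x 0 with h | h | h
  · rcases lt_or_ge (-M) x with h' | h'
    · exact .inr (.inr (.inl ⟨h', h, h2 h' h⟩))
    · exact .inr (.inr (.inr (.inr ⟨h', h4 h'⟩)))
  · exact .inl ⟨h, h0 h⟩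
  · rcases lt_or_ge (M - ε) x with h' | h'
    · exact .inr (.inr (.inr (.inl ⟨h', h3 h'⟩)))
    · exact .inr (.inl ⟨h, h', h1 h h'⟩)

/-- The times of the descent that starts with the edge `2 * j - ε`. -/
def downTime (ε j x : ℤ) : ℕ :=
  (if j < x then 2 * j + 1 - ε - x else if 0 < x then 4 * j + 1 - 3 * x else 4 * j - 1 - x).toNat

/-- The last edge of the descent that starts with the edge `2 * j - ε`. -/
def downEnd (M j : ℤ) : ℤ := if 2 * j ≤ M then 2 * j - M else 2 * j - M + 1

/-- The times of the ascent that starts with the edge `2 * j - ε`, in reflected coordinates and with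
`J = M - j`. -/
def upTime (J y : ℤ) : ℕ :=
  (if J < y then 2 * J + 1 - y else if 0 < y then 4 * J + 3 - 3 * y else 4 * J + 1 - y).toNat

/-- The last edge of the ascent that starts with the edge `2 * (M - J) - ε`, in reflected
coordinates. -/
def upEnd (M J : ℤ) : ℤ := if 2 * J < M then 2 * J - M + 1 else 2 * J - M + 2

variable {M ε j J : ℤ} {A : ℤ → ℕ → Prop}

theorem neg_lt_downEnd (hj : 1 ≤ j) : -M < downEnd M j := by
  unfold downEnd
  split_ifs <;> omega

theorem neg_lt_upEnd (hJ : 1 ≤ J) : 1 - M < upEnd M J := by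
  unfold upEnd
  split_ifs <;> omega

theorem downTime_lt (hε : ε = 0 ∨ ε = 1) (hj : 1 ≤ j) {x : ℤ} (hx : x < 2 * j - ε) :
    downTime ε j (x + 1) < downTime ε j x := by
  unfold downTime
  split_ifs <;> omega

theorem upTime_lt (hJ : 1 ≤ J) {y : ℤ} (hy : y < 2 * J) : upTime J (y + 1) < upTime J y := by
  unfold upTime
  split_ifs <;> omega

/-- The crossing times increase by 1 where the labels used are at least 2 apart (edges beyond j,
edges ≤ 0) and by 3 between the edges j and 1, where they are 4 apart; so no other label fits in
between. At `downEnd` the crossing time 2M - 1 - |x| is the largest label of the edge x, so nothing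
remains for a delayed walk. -/
theorem isRigid_downTime (hε : ε = 0 ∨ ε = 1)
    (hA : ∀ x t, -(2 * M - ε) < x → x < 2 * M - ε → (A x t ↔ posLabel M ε x t))
    (hj : 1 ≤ j) (hjM : j < M) : IsRigid A (2 * j + 1 - ε) (downEnd M j) (downTime ε j) := by
  have hend := neg_lt_downEnd (M := M) hj
  refine ⟨?_, fun x _ hx => downTime_lt hε hj (by omega)⟩
  intro x t hx hxa hAx hlt
  rw [hA x t (by omega) (by omega)] at hAx
  obtain ⟨ht, h | h | h | h | h⟩ := hAx
  all_goals
    try simp only [cwLabel, ccwLabel] at h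
    unfold downEnd at hx ⊢
    unfold downTime at hlt ⊢
    rcases hε with rfl | rfl <;> split_ifs at hx hlt ⊢ <;> omega

theorem isDescent_downTime (hε : ε = 0 ∨ ε = 1)
    (hA : ∀ x t, -(2 * M - ε) < x → x < 2 * M - ε → (A x t ↔ posLabel M ε x t))
    (hj : 1 ≤ j) (hjM : j < M) : IsDescent A (2 * j + 1 - ε) (downEnd M j) (downTime ε j) := by
  have hend := neg_lt_downEnd (M := M) hj
  intro x hx hxa
  refine ⟨?_, fun _ => downTime_lt hε hj (by omega)⟩
  rw [hA x _ (by omega) (by omega)]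
  refine posLabel_of ?_ (fun h => ?_) (fun h h' => ?_) (fun h h' => ?_) (fun h => ?_) fun h => ?_
  all_goals
    try simp only [cwLabel, ccwLabel]
    unfold downEnd at hx
    unfold downTime
    rcases hε with rfl | rfl <;> split_ifs at * <;> omega

/-- Rigidity of ascents is needed only for the labels 4J + 1 of edge 0, which no descent `downTime`
uses; this explains the restriction 2J < M. -/
theorem isRigid_upTime (hε : ε = 0 ∨ ε = 1)
    (hA : ∀ x t, -(2 * M - ε) < x → x < 2 * M - ε → (A x t ↔ posLabel M ε x t))
    (hJ : 1 ≤ J) (hJM : 2 * J < M) :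
    IsRigid (fun k => A (-k)) (2 * J + 1) (upEnd M J) (upTime J) := by
  have hend := neg_lt_upEnd (M := M) hJ
  refine ⟨?_, fun y _ hy => upTime_lt hJ (by omega)⟩
  intro x t hx hxa hAx hlt
  rw [hA (-x) t (by omega) (by omega)] at hAx
  obtain ⟨ht, h | h | h | h | h⟩ := hAx
  all_goals
    try simp only [cwLabel, ccwLabel] at h
    unfold upEnd at hx ⊢
    unfold upTime at hlt ⊢
    rcases hε with rfl | rfl <;> split_ifs at hx hlt ⊢ <;> omega

/-- For odd c the value J = M - 1 is excluded: this ascent would start on edge 1 at time 1, and that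
edge has no label 1. -/
theorem isDescent_upTime (hε : ε = 0 ∨ ε = 1)
    (hA : ∀ x t, -(2 * M - ε) < x → x < 2 * M - ε → (A x t ↔ posLabel M ε x t))
    (hJ : 1 ≤ J) (hJM : J + 1 + ε ≤ M) :
    IsDescent (fun k => A (-k)) (2 * J + 1) (upEnd M J) (upTime J) := by
  have hend := neg_lt_upEnd (M := M) hJ
  intro x hx hxa
  refine ⟨?_, fun hy => upTime_lt hJ (by omega)⟩
  beta_reduce
  rw [hA (-x) _ (by omega) (by omega)]
  refine posLabel_of ?_ (fun h => ?_) (fun h h' => ?_) (fun h h' => ?_) (fun h => ?_) fun h => ?_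
  all_goals
    try simp only [cwLabel, ccwLabel]
    unfold upEnd at hx
    unfold upTime
    rcases hε with rfl | rfl <;> split_ifs at * <;> omega

/-- The start 2J is the reflected image, up to the period, of the start 2j + 1 - ε of the descent
with j = M - J. Only lower bounds for the crossing times matter, so J = M - 1 is allowed for odd c
too. -/
theorem isBlocked_upTime (hε : ε = 0 ∨ ε = 1)
    (hA : ∀ x t, -(2 * M - ε) < x → x < 2 * M - ε → (A x t ↔ posLabel M ε x t))
    (hJ : 1 ≤ J) (hJM : J < M) :
    IsBlocked (fun k => A (-k)) (2 * J) (upEnd M J) (upTime J) := by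
  have hend := neg_lt_upEnd (M := M) hJ
  refine ⟨by unfold upEnd; split_ifs <;> omega, ?_, fun y _ hy => (upTime_lt hJ (by omega)).le, ?_⟩
  · intro x t hx hxa hAx hlt
    rw [hA (-x) t (by omega) (by omega)] at hAx
    obtain ⟨ht, h | h | h | h | h⟩ := hAx
    all_goals
      try simp only [cwLabel, ccwLabel] at h
      unfold upEnd at hx
      unfold upTime at hlt ⊢
      rcases hε with rfl | rfl <;> split_ifs at hx hlt ⊢ <;> omega
  · intro t hAx hlt
    rw [hA _ t (by unfold upEnd at *; split_ifs <;> omega) (by omega)] at hAx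
    clear hend
    obtain ⟨ht, h | h | h | h | h⟩ := hAx
    all_goals
      try simp only [cwLabel, ccwLabel] at h
      unfold upEnd at h hlt
      unfold upTime at hlt
      rcases hε with rfl | rfl <;> split_ifs at h hlt <;> omega

theorem isBlocked_downTime (hε : ε = 0 ∨ ε = 1)
    (hA : ∀ x t, -(2 * M - ε) < x → x < 2 * M - ε → (A x t ↔ posLabel M ε x t))
    (hj : M < 2 * j) (hjM : j < M) :
    IsBlocked A (2 * j - ε) (downEnd M j) (downTime ε j) := by
  have hend : downEnd M j = 2 * j - M + 1 := by unfold downEnd; split_ifs <;> omega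
  rw [hend]
  refine ⟨by omega, ?_, fun x hx hxa => (downTime_lt hε (by omega) (by omega)).le, ?_⟩
  · intro x t hx hxa hAx hlt
    rw [hA x t (by omega) (by omega)] at hAx
    obtain ⟨ht, h | h | h | h | h⟩ := hAx
    all_goals
      try simp only [cwLabel, ccwLabel] at h
      unfold downTime at hlt ⊢
      rcases hε with rfl | rfl <;> split_ifs at hlt ⊢ <;> omega
  · intro t hAx hlt
    rw [hA _ t (by omega) (by omega)] at hAx
    obtain ⟨ht, h | h | h | h | h⟩ := hAx
    all_goals
      try simp only [cwLabel, ccwLabel] at h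
      unfold downTime at hlt
      rcases hε with rfl | rfl <;> split_ifs at hlt <;> omega

/-- The times of the descent that starts with the edge `0`. -/
def startTime (x : ℤ) : ℕ := (if x = 0 then 1 else 3 - x).toNat

theorem startTime_lt {x : ℤ} (hx : x < 0) : startTime (x + 1) < startTime x := by
  unfold startTime
  split_ifs <;> omega

theorem isDescent_startTime (hε : ε = 0 ∨ ε = 1) (hM : 2 ≤ M)
    (hA : ∀ x t, -(2 * M - ε) < x → x < 2 * M - ε → (A x t ↔ posLabel M ε x t)) :
    IsDescent A 1 (2 - M) startTime := by
  intro x hx hxa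
  refine ⟨?_, fun _ => startTime_lt (by omega)⟩
  rw [hA x _ (by omega) (by omega)]
  refine posLabel_of ?_ (fun h => ?_) (fun h h' => ?_) (fun h h' => ?_) (fun h => ?_) fun h => ?_
  all_goals
    try simp only [cwLabel, ccwLabel]
    unfold startTime
    rcases hε with rfl | rfl <;> split_ifs at * <;> omega

theorem isBlocked_startTime (hε : ε = 0 ∨ ε = 1) (hM : 2 ≤ M)
    (hA : ∀ x t, -(2 * M - ε) < x → x < 2 * M - ε → (A x t ↔ posLabel M ε x t)) :
    IsBlocked A 0 (2 - M) startTime := by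
  refine ⟨by omega, ?_, fun x hx hxa => (startTime_lt (by omega)).le, ?_⟩
  · intro x t hx hxa hAx hlt
    rw [hA x t (by omega) (by omega)] at hAx
    obtain ⟨ht, h | h | h | h | h⟩ := hAx
    all_goals
      try simp only [cwLabel, ccwLabel] at h
      unfold startTime at hlt ⊢
      rcases hε with rfl | rfl <;> split_ifs at hlt ⊢ <;> omega
  · intro t hAx hlt
    rw [hA _ t (by omega) (by omega)] at hAx
    obtain ⟨ht, h | h | h | h | h⟩ := hAx
    all_goals
      try simp only [cwLabel, ccwLabel] at h
      unfold startTime at hlt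
      rcases hε with rfl | rfl <;> split_ifs at hlt <;> omega

/-- From vertex 0, edge k is crossed upwards at time k + 1, for k ≤ M - ε. For even c the last edge
needs the label M + 1: this is the purpose of the final label ℓ + 2. -/
theorem isRigid_start (hε : ε = 0 ∨ ε = 1) (hM : 2 ≤ M)
    (hA : ∀ x t, -(2 * M - ε) < x → x < 2 * M - ε → (A x t ↔ posLabel M ε x t)) :
    IsRigid (fun k => A (-k)) 1 (ε - M) (fun y => (1 - y).toNat) := by
  refine ⟨?_, fun x hx hxa => by simp only; omega⟩
  intro x t hx hxa hAx hlt
  beta_reduce at hlt ⊢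
  rw [hA _ t (by omega) (by omega)] at hAx
  obtain ⟨ht, h | h | h | h | h⟩ := hAx
  all_goals
    try simp only [cwLabel, ccwLabel] at h
    rcases hε with rfl | rfl <;> omega

theorem isDescent_start (hε : ε = 0 ∨ ε = 1) (hM : 2 ≤ M)
    (hA : ∀ x t, -(2 * M - ε) < x → x < 2 * M - ε → (A x t ↔ posLabel M ε x t)) :
    IsDescent (fun k => A (-k)) 1 (ε - M) (fun y => (1 - y).toNat) := by
  intro x hx hxa
  refine ⟨?_, fun _ => by simp only; omega⟩
  beta_reduce
  rw [hA _ _ (by omega) (by omega)]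
  refine posLabel_of ?_ (fun h => ?_) (fun h h' => ?_) (fun h h' => ?_) (fun h => ?_) fun h => ?_
  all_goals
    try simp only [cwLabel, ccwLabel]
    rcases hε with rfl | rfl <;> omega

/-- For odd c this is the ascent from vertex 2 that crosses edge k at time k + 1, written one period
away. -/
theorem isDescent_second
    (hA : ∀ x t, -(2 * M - 1) < x → x < 2 * M - 1 → (A x t ↔ posLabel M 1 x t)) :
    IsDescent (fun k => A (-k)) (2 * M - 2) M (fun y => (2 * M - y).toNat) := by
  intro x hx hxa
  refine ⟨?_, fun _ => by simp only; omega⟩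
  beta_reduce
  rw [hA _ _ (by omega) (by omega)]
  refine posLabel_of ?_ (fun h => ?_) (fun h h' => ?_) (fun h h' => ?_) (fun h => ?_) fun h => ?_
  all_goals
    try simp only [cwLabel, ccwLabel]
    omega

end Certificates

end TemporalGraph

namespace TemporalGraph

/-! ### Generator labellings are connected, minimal and proper -/

section CycleLabelling

variable {A : ℤ → ℕ → Prop} {a e a' : ℤ} {τ : ℤ → ℕ}

theorem IsDescent.of_le (h : IsDescent A a e τ) (ha : a' ≤ a) : IsDescent A a' e τ :=
  fun x hx hxa => ⟨(h x hx (by omega)).1, fun hx' => (h x hx (by omega)).2 (by omega)⟩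

theorem IsDescent.shift (h : IsDescent A a e τ) {z : ℤ} (hA : ∀ x t, A x t ↔ A (x + z) t) :
    IsDescent A (a + z) (e + z) fun x => τ (x - z) := by
  intro x hx hxa
  obtain ⟨h1, h2⟩ := h (x - z) (by omega) (by omega)
  refine ⟨?_, fun hx' => ?_⟩
  · rw [hA] at h1
    simpa using h1
  · have := h2 (by omega)
    rwa [show x - z + 1 = x + 1 - z by ring] at this

theorem IsBlocked.shift (h : IsBlocked A a e τ) {z : ℤ} (hA : ∀ x t, A x t ↔ A (x + z) t) :
    IsBlocked A (a + z) (e + z) fun x => τ (x - z) := by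
  obtain ⟨h0, h1, h2, h3⟩ := h
  have hA' : ∀ x t, A x t → A (x - z) t := fun x t hx => (hA (x - z) t).2 (by simpa using hx)
  refine ⟨by omega, ?_, ?_, ?_⟩
  · intro x t hx hxa hAx hlt
    refine h1 (x - z) t (by omega) (by omega) (hA' _ _ hAx) fun hx' => ?_
    have := hlt (by omega)
    beta_reduce at this
    rwa [show x + 1 - z = x - z + 1 by ring] at this
  · intro x hx hxa
    have := h2 (x - z) (by omega) (by omega)
    rwa [show x - z + 1 = x + 1 - z by ring] at this
  · intro t hAt hlt
    refine h3 t ?_ fun he => ?_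
    · have := hA' _ _ hAt
      rwa [show e + z - 1 - z = e - 1 by ring] at this
    · have := hlt (by omega)
      simpa using this

/-- The labels of the edges of a closed walk around a cycle of size `c` form a generator
labelling. -/
structure IsGeneratorLabels (c : ℕ) (M ε : ℤ) (A : ℤ → ℕ → Prop) : Prop where
  parity : ε = 0 ∨ ε = 1
  two_le : 2 ≤ M
  size_eq : (c : ℤ) = 2 * M - ε
  periodic : ∀ x y t, (c : ℤ) ∣ x - y → A x t → A y t
  iff_posLabel : ∀ x t, -(2 * M - ε) < x → x < 2 * M - ε → (A x t ↔ posLabel M ε x t)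

namespace IsGeneratorLabels

variable {c : ℕ} {M ε : ℤ} {V : Type*} {w : ℤ → V}

theorem shift (h : IsGeneratorLabels c M ε A) {z : ℤ} (hz : (c : ℤ) ∣ z) (x : ℤ) (t : ℕ) :
    A x t ↔ A (x + z) t :=
  ⟨h.periodic _ _ _ (by simpa using hz), h.periodic _ _ _ (by simpa using hz)⟩

theorem shift_neg (h : IsGeneratorLabels c M ε A) {z : ℤ} (hz : (c : ℤ) ∣ z) (x : ℤ) (t : ℕ) :
    A (-x) t ↔ A (-(x + z)) t := by
  rw [neg_add]
  exact h.shift ((dvd_neg).2 hz) _ _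

theorem exists_treach (h : IsGeneratorLabels c M ε A) (hw : ∀ x y, w x = w y ↔ (c : ℤ) ∣ x - y)
    (a b : ℤ) : ∃ t, TReach (cycleRel w A) (w a) 0 (w b) t := by
  obtain ⟨hε, hM, hc, hper, hA⟩ := id h
  have hc0 : 0 < c := by omega
  wlog ha : 0 ≤ a ∧ a < c generalizing a
  · have := this (a % c) ⟨Int.emod_nonneg _ (by omega), Int.emod_lt_of_pos _ (by omega)⟩
    rwa [(hw (a % c) a).2] at this
    rw [dvd_sub_comm]
    exact Int.dvd_self_sub_emod
  have hneg : (c : ℤ) ∣ -c := by simp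
  rcases eq_or_ne a 0 with rfl | h0
  · exact ((isDescent_startTime hε hM hA).of_le (by omega)).exists_treach_cycleRel hw hc0
      (isDescent_start hε hM hA) (by omega) b
  rcases eq_or_ne a 1 with rfl | h1
  · exact (isDescent_startTime hε hM hA).exists_treach_cycleRel hw hc0
      ((isDescent_start hε hM hA).of_le (by omega)) (by omega) b
  -- With j = 1 and odd c the general ascent does not exist, so vertex 2 needs its own.
  by_cases h2 : ε = 1 ∧ a = 2
  · obtain ⟨rfl, rfl⟩ := h2
    have hd := isDescent_downTime (j := 1) hε hA le_rfl (by omega)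
    have hu := (isDescent_second hA).shift (z := -c) (h.shift_neg hneg)
    rw [show 2 * M - 2 + -(c : ℤ) = 1 - (2 * 1 + 1 - 1) by omega] at hu
    exact hd.exists_treach_cycleRel hw hc0 hu (by unfold downEnd; split_ifs <;> omega) b
  -- These are the two endpoints of the edge 2j - ε. Both families start with that edge, so one of
  -- the two walks omits its first step.
  obtain ⟨j, hj | hj⟩ : ∃ j, a = 2 * j + 1 - ε ∨ a = 2 * j - ε := ⟨(a + ε) / 2, by omega⟩
  all_goals
    have hd := isDescent_downTime (j := j) hε hA (by omega) (by omega)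
    have hu := (isDescent_upTime (J := M - j) hε hA (by omega) (by omega)).shift
      (z := -c) (h.shift_neg hneg)
    have hsum : downEnd M j + c ≤ 2 - (upEnd M (M - j) + -c) := by
      unfold downEnd upEnd
      split_ifs <;> omega
    exact (hd.of_le (by omega)).exists_treach_cycleRel hw hc0 (hu.of_le (by omega)) hsum b

/-- The indices come from solving the time formulas for j or J. The exceptions are the labels 4J + 1
of edge 0, used by rigid ascents, and label 1 of edge 0 and the extra label M + 1, used by the
ascent from vertex 0. -/
theorem exists_time (hε : ε = 0 ∨ ε = 1) {x t : ℤ} (hx : 0 ≤ x) (hxc : x < 2 * M - ε)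
    (h : posLabel M ε x t) :
    (∃ j y, 1 ≤ j ∧ j < M ∧ downEnd M j ≤ y ∧ y < 2 * j + 1 - ε ∧ (y = x ∨ y = x - (2 * M - ε)) ∧
      (downTime ε j y : ℤ) = t) ∨
    (∃ J, 1 ≤ J ∧ 2 * J < M ∧ x = 0 ∧ t = 4 * J + 1) ∨ (x = 0 ∧ t = 1) ∨
      (ε = 0 ∧ x = M ∧ t = M + 1) := by
  obtain ⟨ht, h | h | h | h | h⟩ := h
  · obtain ⟨rfl, h1, h2⟩ := h
    by_cases h3 : t % 4 = 3
    · refine .inl ⟨(t + 1) / 4, 0, by omega, by omega, ?_, by omega, .inl rfl, ?_⟩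
      · unfold downEnd; split_ifs <;> omega
      · unfold downTime; split_ifs <;> omega
    · by_cases h4 : t = 1
      · exact .inr (.inr (.inl ⟨rfl, h4⟩))
      · exact .inr (.inl ⟨(t - 1) / 4, by omega, by omega, rfl, by omega⟩)
  · obtain ⟨h0, h1, h2 | h2 | h2⟩ := h
    · refine .inl ⟨(t + x - 1 + ε) / 2, x, by omega, by omega, ?_, by omega, .inl rfl, ?_⟩
      · unfold downEnd; split_ifs <;> omega
      · unfold downTime; split_ifs <;> omega
    · refine .inl ⟨(t + 3 * x - 1) / 4, x, by omega, by omega, ?_, by omega, .inl rfl, ?_⟩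
      · unfold downEnd; split_ifs <;> omega
      · unfold downTime; split_ifs <;> omega
    · exact .inr (.inr (.inr h2))
  · omega
  · obtain ⟨h0, h2 | h2⟩ := h
    · refine .inl ⟨(t - (2 * M - ε - x) - 1) / 2 + M, x, by omega, by omega, ?_, by omega,
        .inl rfl, ?_⟩
      · unfold downEnd; split_ifs <;> omega
      · unfold downTime; split_ifs <;> omega
    -- The descent meets this edge below 0, at position x - c, hence the second alternative for y.
    · refine .inl ⟨(t - (2 * M - ε - x) + 1) / 4, x - (2 * M - ε), by omega, by omega, ?_,
        by omega, .inr rfl, ?_⟩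
      · unfold downEnd; split_ifs <;> omega
      · unfold downTime; split_ifs <;> omega
  · omega

/-- The separated pair consists of the start and the end of a rigid walk through the label. In the
opposite direction the same start is blocked, with the two ranges covering each residue once. -/
theorem exists_not_treach (h : IsGeneratorLabels c M ε A)
    (hw : ∀ x y, w x = w y ↔ (c : ℤ) ∣ x - y) {x y : V} {t₀ : ℕ} (hxy : cycleRel w A x y t₀) :
    ∃ a b, ∀ t, ¬ TReach (fun p q t => cycleRel w A p q t ∧ ¬ (s(p, q) = s(x, y) ∧ t = t₀))
      (w a) 0 (w b) t := by
  obtain ⟨hε, hM, hc, hper, hA⟩ := id h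
  obtain ⟨k, hk, hkxy⟩ := hxy
  have hedge : s(x, y) = s(w k, w (k + 1)) := by
    rcases hkxy with ⟨rfl, rfl⟩ | ⟨rfl, rfl⟩
    · rfl
    · exact Sym2.eq_swap
  rw [hedge]
  clear hedge hkxy x y
  wlog hk0 : 0 ≤ k ∧ k < c generalizing k
  · have hd : (c : ℤ) ∣ k % c - k := by rw [dvd_sub_comm]; exact Int.dvd_self_sub_emod
    have := this (k % c) (hper _ _ _ (dvd_sub_comm.1 hd) hk)
      ⟨Int.emod_nonneg _ (by omega), Int.emod_lt_of_pos _ (by omega)⟩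
    rwa [(hw (k % c) k).2 hd, (hw (k % c + 1) (k + 1)).2 (by simpa using hd)] at this
  have hneg : (c : ℤ) ∣ -c := by simp
  have hw' : ∀ x y, w (1 - x) = w (1 - y) ↔ (c : ℤ) ∣ x - y := by
    intro x y
    rw [hw, dvd_sub_comm]
    simp
  have hper' : ∀ x y t, (c : ℤ) ∣ x - y → A (-x) t → A (-y) t := fun x y t hd hx =>
    hper _ _ _ (by rwa [show -x - -y = -(x - y) by ring, dvd_neg]) hx
  have hrefl : ∀ y : ℤ, s(w (1 - y), w (1 - (y + 1))) = s(w (-y), w (-y + 1)) := fun y => by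
    rw [Sym2.eq_swap, show 1 - (y + 1) = -y by ring, show 1 - y = -y + 1 by ring]
  rcases exists_time hε hk0.1 (by omega) ((hA k t₀ (by omega) (by omega)).1 hk) with
    ⟨j, y, hj, hjM, hy, hya, hyk, ht⟩ | ⟨J, hJ, hJM, rfl, ht⟩ | hst
  · have hwy : w y = w k ∧ w (y + 1) = w (k + 1) := by
      rcases hyk with rfl | rfl
      · exact ⟨rfl, rfl⟩
      · refine ⟨(hw _ _).2 ⟨-1, by omega⟩, (hw _ _).2 ⟨-1, by omega⟩⟩
    have hu := (isBlocked_upTime (J := M - j) hε hA (by omega) (by omega)).shift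
      (z := -c) (h.shift_neg hneg)
    rw [show 2 * (M - j) + -(c : ℤ) = 1 - (2 * j + 1 - ε) by omega] at hu
    refine ⟨2 * j + 1 - ε, downEnd M j, fun t => ?_⟩
    have := (isRigid_downTime hε hA hj hjM).not_treach_cycleRel hw hper hu
      (by unfold downEnd upEnd; split_ifs <;> omega) hy hya t
    rwa [hwy.1, hwy.2, show downTime ε j y = t₀ by omega] at this
  · have hd := (isBlocked_downTime (j := M - J) hε hA (by omega) (by omega)).shift
      (z := -c) (h.shift hneg)
    rw [show 2 * (M - J) - ε + -(c : ℤ) = 1 - (2 * J + 1) by omega] at hd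
    refine ⟨1 - (2 * J + 1), 1 - upEnd M J, fun t => ?_⟩
    have := (isRigid_upTime hε hA hJ hJM).not_treach_cycleRel (w := fun k => w (1 - k))
      (A := fun k => A (-k)) hw' hper' (by simpa using hd)
      (by unfold downEnd upEnd; split_ifs <;> omega) (d := 0)
      (by unfold upEnd; split_ifs <;> omega) (by omega) t
    rw [cycleRel_reflect, hrefl] at this
    rwa [show upTime J 0 = t₀ by rw [upTime, if_neg (by omega), if_neg (by omega)]; omega] at this
  · have hb := isBlocked_startTime hε hM hA
    refine ⟨1 - 1, 1 - (ε - M), fun t => ?_⟩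
    have := (isRigid_start hε hM hA).not_treach_cycleRel (w := fun k => w (1 - k))
      (A := fun k => A (-k)) hw' hper' (e' := 2 - M) (τ' := startTime) (by simpa using hb)
      (by omega) (d := -k) (by omega) (by omega) t
    rw [cycleRel_reflect, hrefl] at this
    rwa [show (1 - -k).toNat = t₀ by omega, neg_neg] at this

theorem cycleRel_unique (h : IsGeneratorLabels c M ε A)
    (hw : ∀ x y, w x = w y ↔ (c : ℤ) ∣ x - y) {x y z : V} {t : ℕ}
    (hxy : cycleRel w A x y t) (hxz : cycleRel w A x z t) : y = z := by
  obtain ⟨hε, hM, hc, hper, hA⟩ := id h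
  have key : ∀ k, A k t → ¬ A (k + 1) t := by
    intro k h1 h2
    have hd : (c : ℤ) ∣ k % c - k := by rw [dvd_sub_comm]; exact Int.dvd_self_sub_emod
    have hk0 := Int.emod_nonneg k (show (c : ℤ) ≠ 0 by omega)
    have hk1 := Int.emod_lt_of_pos k (show (0 : ℤ) < c by omega)
    replace h1 := hper _ (k % c) t (by rwa [dvd_sub_comm]) h1
    -- Edge k is moved to [0, c) and its successor to (-c, 0], so that `posLabel` describes both,
    -- even across the seam.
    have hd' : (c : ℤ) ∣ k + 1 - (k % c - c + 1) := by
      rw [show k + 1 - (k % c - c + 1) = k - k % c + c by ring]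
      exact dvd_add Int.dvd_self_sub_emod (dvd_refl _)
    replace h2 := hper _ (k % c - c + 1) t hd' h2
    generalize k % (c : ℤ) = x at *
    rw [hA _ _ (by omega) (by omega)] at h1 h2
    obtain ⟨ht, h1⟩ := h1
    obtain ⟨-, h2⟩ := h2
    unfold cwLabel ccwLabel at h1 h2
    rcases hε with rfl | rfl
    · rcases h1 with h1 | h1 | h1 | h1 | h1 <;> rcases h2 with h2 | h2 | h2 | h2 | h2 <;> omega
    · rcases h1 with h1 | h1 | h1 | h1 | h1 <;> rcases h2 with h2 | h2 | h2 | h2 | h2 <;> omega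
  have key' : ∀ k l, A k t → A l t → ¬ (c : ℤ) ∣ (k + 1) - l := fun k l h1 h2 hd =>
    key k h1 (hper _ _ _ (by rwa [dvd_sub_comm]) h2)
  obtain ⟨k, hk, ⟨h1, h2⟩ | ⟨h1, h2⟩⟩ := hxy <;> obtain ⟨l, hl, ⟨h3, h4⟩ | ⟨h3, h4⟩⟩ := hxz <;>
    rw [h1, hw] at h3
  · rw [h2, h4, hw]; simpa using h3
  · exact absurd (dvd_sub_comm.1 h3) (key' l k hl hk)
  · exact absurd h3 (key' k l hk hl)
  · rw [h2, h4, hw]; simpa using h3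

end IsGeneratorLabels

end CycleLabelling

end TemporalGraph

namespace TemporalGraph

/-! ### Closed forms of the generator rounds -/

section Generator

/-- The arithmetic progression of length `n` that starts with `b` and has common
difference `d`. -/
def progression (b d n : ℕ) : List ℕ := (List.range n).map fun k => b + d * k

theorem progression_succ (b d n : ℕ) :
    progression b d (n + 1) = b :: progression (b + d) d n := by
  simp only [progression, List.range_succ_eq_map, List.map_cons, List.map_map]
  congr 1
  refine List.map_congr_left fun k _ => ?_
  simp only [Function.comp]
  rw [Nat.mul_succ]
  omega

theorem progression_succ' (b d n : ℕ) :
    progression b d (n + 1) = progression b d n ++ [b + d * n] := by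
  simp [progression, List.range_succ]

theorem dropLast_progression (b d n : ℕ) :
    (progression b d n).dropLast = progression b d (n - 1) := by
  cases n with
  | zero => rfl
  | succ n => rw [progression_succ', List.dropLast_concat, Nat.add_sub_cancel]

theorem getElem?_progression (b d n k t : ℕ) :
    (progression b d n)[k]? = some t ↔ k < n ∧ t = b + d * k := by
  simp only [progression, List.getElem?_map, Option.map_eq_some_iff]
  constructor
  · rintro ⟨a, ha, rfl⟩
    rw [List.getElem?_eq_some_iff] at ha
    obtain ⟨h, rfl⟩ := ha
    simp only [List.length_range] at h
    exact ⟨h, by simp⟩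
  · rintro ⟨h, rfl⟩
    exact ⟨k, by simp [h], rfl⟩

theorem mem_progression (b d n t : ℕ) : t ∈ progression b d n ↔ ∃ k < n, t = b + d * k := by
  rw [List.mem_iff_getElem?]
  simp only [getElem?_progression]

theorem mem_everySecond (l : List ℕ) (t : ℕ) : t ∈ everySecond l ↔ ∃ k, l[2 * k]? = some t := by
  induction l using everySecond.induct with
  | case1 => simp [everySecond]
  | case2 a =>
    simp only [everySecond, List.mem_singleton]
    constructor
    · rintro rfl
      exact ⟨0, rfl⟩
    · rintro ⟨k, hk⟩
      cases k with
      | zero => simpa using hk.symm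
      | succ k => simp [Nat.mul_succ] at hk
  | case3 a b l ih =>
    simp only [everySecond, List.mem_cons, ih]
    constructor
    · rintro (rfl | ⟨k, hk⟩)
      · exact ⟨0, rfl⟩
      · exact ⟨k + 1, by simpa [Nat.mul_succ] using hk⟩
    · rintro ⟨k, hk⟩
      cases k with
      | zero => exact .inl (by simpa using hk.symm)
      | succ k => exact .inr ⟨k, by simpa [Nat.mul_succ] using hk⟩

theorem oddsUpTo_eq (m : ℕ) : oddsUpTo m = progression 1 2 ((m + 1) / 2) := by
  induction m with
  | zero => rfl
  | succ m ih =>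
    have : oddsUpTo (m + 1) = oddsUpTo m ++ if (m + 1) % 2 = 1 then [m + 1] else [] := by
      simp only [oddsUpTo, List.range_succ (n := m + 1), List.filter_append]
      congr 1
      split_ifs with h <;> simp [h]
    rw [this, ih]
    split_ifs with h
    · rw [show (m + 1 + 1) / 2 = (m + 1) / 2 + 1 by omega, progression_succ']
      congr 2
      omega
    · rw [show (m + 1 + 1) / 2 = (m + 1) / 2 by omega, List.append_nil]

theorem evensUpTo_eq (m : ℕ) : evensUpTo m = progression 2 2 (m / 2) := by
  induction m with
  | zero => rfl
  | succ m ih =>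
    have : evensUpTo (m + 1) = evensUpTo m ++ if (m + 1) % 2 = 0 then [m + 1] else [] := by
      simp only [evensUpTo, List.range_succ (n := m + 1), List.filter_append]
      congr 1
      split_ifs with h <;> simp [h]
    rw [this, ih]
    split_ifs with h
    · rw [show (m + 1) / 2 = m / 2 + 1 by omega, progression_succ']
      congr 2
      omega
    · rw [show (m + 1) / 2 = m / 2 by omega, List.append_nil]

theorem moveLabels_progression (l : List ℕ) (b n : ℕ) (hn : 0 < n) :
    moveLabels (l, progression b 2 n) = (l ++ [b], progression (b + 2) 2 (n - 2)) := by
  obtain ⟨n, rfl⟩ := Nat.exists_eq_add_of_lt hn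
  rw [zero_add, progression_succ, moveLabels, dropLast_progression]
  rfl

/-- The bound on k guarantees that the second list is non-empty before every move; natural
subtraction absorbs the final move from a singleton. -/
theorem iterate_moveLabels (b n k : ℕ) (hk : 2 * k ≤ n + 1) :
    moveLabels^[k] ([], progression b 2 n) =
      (progression b 2 k, progression (b + 2 * k) 2 (n - 2 * k)) := by
  induction k with
  | zero => rfl
  | succ k ih =>
    rw [Function.iterate_succ_apply', ih (by omega), moveLabels_progression _ _ _ (by omega),
      progression_succ', Nat.mul_succ, Nat.sub_sub, add_assoc]

theorem evenState_eq (M r : ℕ) (hM : 0 < M) (hr : r ≤ M) :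
    evenState (2 * M) r = (progression (1 + r % 2) 2 (r / 2), progression (1 + r) 2 (M - r)) := by
  unfold evenState
  rcases Nat.mod_two_eq_zero_or_one r with h | h
  · rw [if_pos h, oddsUpTo_eq, iterate_moveLabels _ _ _ (by omega), h]
    congr 2 <;> omega
  · rw [if_neg (by omega), evensUpTo_eq, iterate_moveLabels _ _ _ (by omega), h]
    congr 2 <;> omega

/-- For odd c a single L' is fed alternately by L₁ and L₂, so it collects all of 1, …, r rather than
one parity class. -/
theorem oddState_eq (m r : ℕ) (hr : r ≤ m) :
    oddState (2 * m + 1) r =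
      (progression 1 1 r, progression (r + 1) 2 (m - r), progression (r + 2) 2 (m - r - 1)) := by
  induction r with
  | zero =>
    simp only [oddState, oddsUpTo_eq, evensUpTo_eq, dropLast_progression]
    congr 3 <;> omega
  | succ r ih =>
    simp only [oddState, ih (by omega)]
    rw [moveLabels_progression _ _ _ (by omega), progression_succ']
    refine Prod.ext ?_ (Prod.ext rfl ?_)
    · simp only [one_mul, add_comm]
    · simp only [Nat.sub_sub]

theorem mem_generatorRound_even {M r t : ℕ} (hM : 0 < M) (hr : r ≤ M) :
    (t ∈ (generatorRound (2 * M) r).1 ↔ 1 ≤ t ∧ ((((t : ℤ) - r - 1) % 2 = 0 ∧ (t : ℤ) ≤ r - 1) ∨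
      (((t : ℤ) - r - 1) % 4 = 0 ∧ (r : ℤ) + 1 ≤ t ∧ (t : ℤ) ≤ 2 * M - 1 - r))) ∧
    (t ∈ (generatorRound (2 * M) r).2 ↔ 1 ≤ t ∧ ccwLabel M r t) := by
  simp only [generatorRound, Nat.mul_mod_right, if_true, evenState_eq M r hM hr, List.mem_append,
    mem_everySecond, List.getElem?_tail, mem_progression, getElem?_progression, ccwLabel]
  constructor
  · constructor
    · rintro (⟨k, hk, rfl⟩ | ⟨k, hk, rfl⟩) <;> omega
    · rintro ⟨ht, h | h⟩
      · exact .inl ⟨(t - 1) / 2, by omega, by omega⟩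
      · exact .inr ⟨(t - r - 1) / 4, by omega, by omega⟩
  · constructor
    · rintro (⟨k, hk, rfl⟩ | ⟨k, hk, rfl⟩) <;> omega
    · rintro ⟨ht, h | h⟩
      · exact .inl ⟨(t - 1) / 2, by omega, by omega⟩
      · exact .inr ⟨(t - r - 3) / 4, by omega, by omega⟩

theorem mem_generatorRound_odd_zero {m t : ℕ} :
    (t ∈ (generatorRound (2 * m + 1) 0).1 ↔ t % 2 = 1 ∧ t ≤ 2 * m + 1) ∧
    (t ∈ (generatorRound (2 * m + 1) 0).2 ↔ t % 2 = 1 ∧ t ≤ 2 * m + 1) := by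
  have h : ¬ (2 * m + 1) % 2 = 0 := by omega
  simp only [generatorRound, if_neg h, oddsUpTo_eq, mem_progression]
  refine and_self_iff.2 ⟨?_, fun h => ⟨t / 2, by omega, by omega⟩⟩
  rintro ⟨k, hk, rfl⟩
  omega

theorem mem_generatorRound_odd {m r t : ℕ} (hr0 : 0 < r) (hr : r ≤ m) :
    (t ∈ (generatorRound (2 * m + 1) r).1 ↔ 1 ≤ t ∧ ((((t : ℤ) - r) % 2 = 0 ∧ (t : ℤ) ≤ r - 2) ∨
      (((t : ℤ) - r - 1) % 4 = 0 ∧ (r : ℤ) + 1 ≤ t ∧ (t : ℤ) ≤ 2 * m + 1 - r))) ∧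
    (t ∈ (generatorRound (2 * m + 1) r).2 ↔ 1 ≤ t ∧ ccwLabel (m + 1) r t) := by
  have h : ¬ (2 * m + 1) % 2 = 0 := by omega
  match r, hr0 with
  | 1, _ =>
    simp only [generatorRound, if_neg h, evensUpTo_eq, mem_everySecond, List.getElem?_tail,
      getElem?_progression, ccwLabel]
    constructor
    · constructor
      · rintro ⟨k, hk, rfl⟩; omega
      · intro h; exact ⟨(t - 2) / 4, by omega, by omega⟩
    · constructor
      · rintro ⟨k, hk, rfl⟩; omega
      · intro h; exact ⟨(t - 4) / 4, by omega, by omega⟩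
  | r + 2, _ =>
    have key : ∀ k, (progression 1 1 r ++ progression (r + 1) 2 (m - r))[k]? = some t ↔
        (k < r ∧ t = k + 1) ∨ (r ≤ k ∧ k < m ∧ t + r = 2 * k + 1) := by
      intro k
      rw [List.getElem?_append]
      have hlen : (progression 1 1 r).length = r := by simp [progression]
      rw [hlen]
      split_ifs with hk <;> rw [getElem?_progression] <;> omega
    have h1 : (∃ k, (progression 1 1 r ++ progression (r + 1) 2 (m - r))[2 * k]? = some t) ↔
        1 ≤ t ∧ ((t % 2 = 1 ∧ t ≤ r) ∨ (r + 1 ≤ t ∧ t + r + 2 ≤ 2 * m + 1 ∧ (t + r) % 4 = 1)) := by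
      simp only [key]
      constructor
      · rintro ⟨k, hk⟩; omega
      · rintro ⟨ht, hk | hk⟩
        · exact ⟨(t - 1) / 2, by omega⟩
        · exact ⟨(t + r) / 4, by omega⟩
    have h2 : (∃ k, (progression 1 1 r ++ progression (r + 1) 2 (m - r))[2 * k + 1]? = some t) ↔
        1 ≤ t ∧ ((t % 2 = 0 ∧ t ≤ r) ∨ (r + 1 ≤ t ∧ t + r + 2 ≤ 2 * m + 1 ∧ (t + r) % 4 = 3)) := by
      simp only [key]
      constructor
      · rintro ⟨k, hk⟩; omega
      · rintro ⟨ht, hk | hk⟩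
        · exact ⟨(t - 1) / 2, by omega⟩
        · exact ⟨(t + r) / 4, by omega⟩
    simp only [generatorRound, if_neg h, oddState_eq m r (by omega)]
    split_ifs with hr2 <;> simp only [mem_everySecond, List.getElem?_tail, h1, h2, ccwLabel] <;>
      push_cast <;> constructor <;> omega

end Generator

end TemporalGraph

namespace TemporalGraph

/-! ### Labels per edge and their number -/

section GeneratorLabels

theorem mem_generatorRoundLabels {c i t : ℕ} : t ∈ generatorRoundLabels c i ↔
    (i ≤ c / 2 ∧ t ∈ (generatorRound c i).1) ∨
    ((c - i) % c ≤ c / 2 ∧ t ∈ (generatorRound c ((c - i) % c)).2) := by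
  unfold generatorRoundLabels
  rw [Finset.mem_union]
  refine or_congr ?_ ?_ <;> split_ifs with h <;> simp [h]

theorem mem_generatorRoundLabels_even {M i t : ℕ} (hM : 0 < M) (hi : i < 2 * M) :
    t ∈ generatorRoundLabels (2 * M) i ↔ posLabel M 0 i t ∧ ¬ (i = M ∧ t = M + 1) := by
  rw [mem_generatorRoundLabels, show 2 * M / 2 = M by omega]
  rcases Nat.eq_zero_or_pos i with rfl | h0
  · rw [Nat.sub_zero, Nat.mod_self, (mem_generatorRound_even hM (Nat.zero_le M)).1,
      (mem_generatorRound_even hM (Nat.zero_le M)).2]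
    unfold posLabel ccwLabel
    constructor
    · intro h
      exact ⟨⟨by omega, .inl ⟨rfl, by omega, by omega⟩⟩, by omega⟩
    · rintro ⟨⟨h, h' | h' | h' | h' | h'⟩, -⟩ <;> omega
  · rw [Nat.mod_eq_of_lt (by omega)]
    have h1 : (i ≤ M ∧ t ∈ (generatorRound (2 * M) i).1) ↔ i ≤ M ∧ 1 ≤ t ∧
        ((((t : ℤ) - i - 1) % 2 = 0 ∧ (t : ℤ) ≤ i - 1) ∨
        (((t : ℤ) - i - 1) % 4 = 0 ∧ (i : ℤ) + 1 ≤ t ∧ (t : ℤ) ≤ 2 * M - 1 - i)) :=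
      and_congr_right fun h => (mem_generatorRound_even hM h).1
    have h2 : (2 * M - i ≤ M ∧ t ∈ (generatorRound (2 * M) (2 * M - i)).2) ↔ M ≤ i ∧ 1 ≤ t ∧
        ccwLabel M (2 * M - 0 - i) t := by
      rw [show (2 * M - i ≤ M ↔ M ≤ i) by omega]
      refine and_congr_right fun h => ?_
      rw [(mem_generatorRound_even hM (show 2 * M - i ≤ M by omega)).2]
      rw [show ((2 * M - i : ℕ) : ℤ) = 2 * M - 0 - i by omega]
    rw [h1, h2]
    clear h1 h2
    unfold posLabel cwLabel ccwLabel
    constructor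
    · rintro (⟨hi, ht, h⟩ | ⟨hi, ht, h⟩)
      · refine ⟨⟨by omega, .inr (.inl ⟨by omega, by omega, by omega⟩)⟩, by omega⟩
      -- At i = M the two edges of the last round coincide, and the counter-clockwise labels are
      -- also clockwise ones.
      · rcases hi.eq_or_lt with rfl | hi
        · refine ⟨⟨by omega, .inr (.inl ⟨by omega, by omega, by omega⟩)⟩, by omega⟩
        · refine ⟨⟨by omega, .inr (.inr (.inr (.inl ⟨by omega, by omega⟩)))⟩, by omega⟩
    · rintro ⟨⟨ht, h | h | h | h | h⟩, hne⟩
      · omega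
      · exact .inl ⟨by omega, by omega, by omega⟩
      · omega
      · exact .inr ⟨by omega, by omega, by omega⟩
      · omega

theorem mem_generatorRoundLabels_odd {m i t : ℕ} (hm : 0 < m) (hi : i < 2 * m + 1) :
    t ∈ generatorRoundLabels (2 * m + 1) i ↔ posLabel (m + 1) 1 i t := by
  rw [mem_generatorRoundLabels, show (2 * m + 1) / 2 = m by omega]
  rcases Nat.eq_zero_or_pos i with rfl | h0
  · rw [Nat.sub_zero, Nat.mod_self, mem_generatorRound_odd_zero.1, mem_generatorRound_odd_zero.2]
    unfold posLabel
    constructor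
    · intro h
      exact ⟨by omega, .inl ⟨rfl, by omega⟩⟩
    · rintro ⟨h, h' | h' | h' | h' | h'⟩ <;> omega
  · rw [Nat.mod_eq_of_lt (by omega)]
    have h1 : (i ≤ m ∧ t ∈ (generatorRound (2 * m + 1) i).1) ↔ i ≤ m ∧ 1 ≤ t ∧
        ((((t : ℤ) - i) % 2 = 0 ∧ (t : ℤ) ≤ i - 2) ∨
        (((t : ℤ) - i - 1) % 4 = 0 ∧ (i : ℤ) + 1 ≤ t ∧ (t : ℤ) ≤ 2 * m + 1 - i)) :=
      and_congr_right fun h => (mem_generatorRound_odd h0 h).1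
    have h2 : (2 * m + 1 - i ≤ m ∧ t ∈ (generatorRound (2 * m + 1) (2 * m + 1 - i)).2) ↔
        m + 1 ≤ i ∧ 1 ≤ t ∧ ccwLabel (m + 1) (2 * (m + 1) - 1 - i) t := by
      rw [show (2 * m + 1 - i ≤ m ↔ m + 1 ≤ i) by omega]
      refine and_congr_right fun h => ?_
      rw [(mem_generatorRound_odd (by omega) (show 2 * m + 1 - i ≤ m by omega)).2]
      rw [show ((2 * m + 1 - i : ℕ) : ℤ) = 2 * (m + 1) - 1 - i by omega]
    rw [h1, h2]
    clear h1 h2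
    unfold posLabel cwLabel ccwLabel
    constructor
    · rintro (⟨hi, ht, h⟩ | ⟨hi, ht, h⟩)
      · exact ⟨by omega, .inr (.inl ⟨by omega, by omega, by omega⟩)⟩
      · exact ⟨by omega, .inr (.inr (.inr (.inl ⟨by omega, by omega⟩)))⟩
    · rintro ⟨ht, h | h | h | h | h⟩
      · omega
      · exact .inl ⟨by omega, by omega, by omega⟩
      · omega
      · exact .inr ⟨by omega, by omega, by omega⟩
      · omega

theorem sup_generatorRoundLabels {M : ℕ} (hM : 2 ≤ M) :
    (generatorRoundLabels (2 * M) M).sup id = M - 1 := by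
  apply le_antisymm
  · refine Finset.sup_le fun t ht => ?_
    rw [mem_generatorRoundLabels_even (by omega) (by omega)] at ht
    obtain ⟨⟨ht, h⟩, hne⟩ := ht
    unfold cwLabel ccwLabel at h
    simp only [id]
    omega
  · refine Finset.le_sup (f := id) ?_
    rw [mem_generatorRoundLabels_even (by omega) (by omega)]
    refine ⟨⟨by omega, .inr (.inl ⟨by omega, by omega, .inl ⟨by omega, by omega⟩⟩)⟩, by omega⟩

/-- The parameters `M` and `ε` of `posLabel` for a cycle of size `c`. -/
theorem mem_generatorLabels {c i t : ℕ} (hc : 3 ≤ c) (hi : i < c) :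
    t ∈ generatorLabels c i ↔ posLabel ((c + 1) / 2 : ℕ) (c % 2 : ℕ) i t := by
  unfold generatorLabels
  rcases Nat.even_or_odd' c with ⟨M, rfl | rfl⟩
  · rw [show (2 * M + 1) / 2 = M by omega, show 2 * M % 2 = 0 by omega,
      show 2 * M / 2 = M by omega]
    split_ifs with h
    · obtain ⟨-, rfl⟩ := h
      rw [Finset.mem_insert, sup_generatorRoundLabels (by omega),
        mem_generatorRoundLabels_even (by omega) (by omega)]
      constructor
      · rintro (h | h)
        · refine ⟨by omega, .inr (.inl ⟨by omega, by omega, .inr (.inr ⟨rfl, rfl, by omega⟩)⟩)⟩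
        · exact h.1
      · intro h
        by_cases ht : t = i + 1
        · exact .inl (by omega)
        · exact .inr ⟨h, fun h' => ht h'.2⟩
    · rw [mem_generatorRoundLabels_even (by omega) (by omega), Nat.cast_zero]
      refine and_iff_left ?_
      rintro ⟨rfl, -⟩
      exact h ⟨rfl, rfl⟩
  · rw [if_neg (by omega), mem_generatorRoundLabels_odd (by omega) hi,
      show (2 * M + 1 + 1) / 2 = M + 1 by omega, show (2 * M + 1) % 2 = 1 by omega]
    push_cast
    rfl

theorem posLabel_add {M ε x t : ℤ} (hε : ε = 0 ∨ ε = 1) (hx : x < 0) (hx' : -(2 * M - ε) < x) :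
    posLabel M ε (x + (2 * M - ε)) t ↔ posLabel M ε x t := by
  unfold posLabel
  refine and_congr_right fun ht => ?_
  constructor
  · rintro (h | h | h | h | h)
    · omega
    · exact .inr (.inr (.inr (.inr ⟨by omega, h.2.2⟩)))
    · omega
    · refine .inr (.inr (.inl ⟨by omega, by omega, ?_⟩))
      convert h.2 using 1
      ring
    · omega
  · rintro (h | h | h | h | h)
    · omega
    · omega
    · refine .inr (.inr (.inr (.inl ⟨by omega, ?_⟩)))
      convert h.2.2 using 1
      ring
    · omega
    · exact .inr (.inl ⟨by omega, by omega, h.2⟩)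

/-- The generator labelling around a cycle of size `c`, with positions taken modulo `c`. -/
def generatorAt (c : ℕ) (x : ℤ) (t : ℕ) : Prop := t ∈ generatorLabels c (x % c).toNat

theorem isGeneratorLabels_generatorAt {c : ℕ} (hc : 3 ≤ c) :
    IsGeneratorLabels c ((c + 1) / 2 : ℕ) (c % 2 : ℕ) (generatorAt c) where
  parity := by omega
  two_le := by omega
  size_eq := by omega
  periodic := by
    intro x y t h hx
    unfold generatorAt at *
    rwa [Int.emod_eq_emod_iff_emod_sub_eq_zero.2 (Int.emod_eq_zero_of_dvd h)] at hx
  iff_posLabel := by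
    intro x t h1 h2
    have hcM : (2 * ((c + 1) / 2 : ℕ) - (c % 2 : ℕ) : ℤ) = c := by omega
    have h0 := Int.emod_nonneg x (show (c : ℤ) ≠ 0 by omega)
    have hlt := Int.emod_lt_of_pos x (show (0 : ℤ) < c by omega)
    unfold generatorAt
    rw [mem_generatorLabels hc (by omega), Int.toNat_of_nonneg h0]
    rcases lt_or_ge x 0 with hx | hx
    · have : x % c = x + (2 * ((c + 1) / 2 : ℕ) - (c % 2 : ℕ)) := by
        rw [hcM, ← Int.add_emod_right, Int.emod_eq_of_lt (by omega) (by omega)]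
      rw [this, posLabel_add (by omega) hx h1]
    · rw [Int.emod_eq_of_lt hx (by omega)]

theorem le_generatorMax {c i t : ℕ} (hi : i < c) (ht : t ∈ generatorLabels c i) :
    t ≤ generatorMax c :=
  (Finset.le_sup (f := id) ht).trans
    (Finset.le_sup (f := fun i => (generatorLabels c i).sup id) (Finset.mem_range.2 hi))

theorem le_card_of_injOn {n : ℕ} {s : Finset ℕ} (f : ℕ → ℕ) (hf : ∀ k < n, f k ∈ s)
    (hinj : ∀ k < n, ∀ l < n, f k = f l → k = l) : n ≤ s.card := by
  have := Finset.card_le_card_of_injOn (s := Finset.range n) f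
    (fun k hk => hf k (Finset.mem_range.1 hk))
    (fun k hk l hl h => hinj k (by simpa using hk) l (by simpa using hl) h)
  simpa using this

theorem le_card_generatorLabels_zero {c : ℕ} (hc : 3 ≤ c) :
    (c + 1) / 2 ≤ (generatorLabels c 0).card := by
  refine le_card_of_injOn (fun k => 2 * k + 1) (fun k hk => ?_) fun k _ l _ h => by omega
  rw [mem_generatorLabels hc (by omega)]
  exact ⟨by omega, .inl ⟨rfl, by omega, by omega⟩⟩

/-- Each of the ⌊r/2⌋ entries of L' is given to both edges and each of the M - r entries of L to
one: the union contains all of them, the intersection contains L'. -/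
theorem le_card_add_card_even {M r : ℕ} (hr : 0 < r) (hrM : r < M) :
    M - r + 2 * (r / 2) ≤
      (generatorLabels (2 * M) r).card + (generatorLabels (2 * M) (2 * M - r)).card := by
  classical
  rw [← Finset.card_union_add_card_inter]
  have hmem : ∀ t, t ∈ generatorLabels (2 * M) r ↔ posLabel M 0 r t := fun t => by
    rw [mem_generatorLabels (by omega) (by omega), show (2 * M + 1) / 2 = M by omega,
      Nat.mul_mod_right]
    rfl
  have hmem' : ∀ t, t ∈ generatorLabels (2 * M) (2 * M - r) ↔
      posLabel M 0 (2 * M - r : ℕ) t := fun t => by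
    rw [mem_generatorLabels (by omega) (by omega), show (2 * M + 1) / 2 = M by omega,
      Nat.mul_mod_right]
    rfl
  have h1 : M - r + r / 2 ≤ (generatorLabels (2 * M) r ∪ generatorLabels (2 * M) (2 * M - r)).card := by
    refine le_card_of_injOn (fun k => 2 * k + 1 + r % 2) (fun k hk => ?_)
      fun k _ l _ h => by omega
    rw [Finset.mem_union, hmem, hmem']
    by_cases hcw : 2 * k + 1 + r % 2 < r ∨ (2 * k + r % 2 - r) % 4 = 0
    · refine .inl ⟨by omega, .inr (.inl ⟨by omega, by omega, ?_⟩)⟩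
      unfold cwLabel; omega
    · refine .inr ⟨by omega, .inr (.inr (.inr (.inl ⟨by omega, ?_⟩)))⟩
      unfold ccwLabel; omega
  have h2 : r / 2 ≤ (generatorLabels (2 * M) r ∩ generatorLabels (2 * M) (2 * M - r)).card := by
    refine le_card_of_injOn (fun k => 2 * k + 1 + r % 2) (fun k hk => ?_)
      fun k _ l _ h => by omega
    rw [Finset.mem_inter, hmem, hmem']
    refine ⟨⟨by omega, .inr (.inl ⟨by omega, by omega, ?_⟩)⟩,
      by omega, .inr (.inr (.inr (.inl ⟨by omega, ?_⟩)))⟩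
    · unfold cwLabel; omega
    · unfold ccwLabel; omega
  omega

theorem le_card_even {M : ℕ} (hM : 2 ≤ M) : M / 2 + 1 ≤ (generatorLabels (2 * M) M).card := by
  refine le_card_of_injOn (fun k => 2 * k + 1 + M % 2) (fun k hk => ?_)
    fun k _ l _ h => by omega
  rw [mem_generatorLabels (by omega) (by omega), show (2 * M + 1) / 2 = M by omega,
    Nat.mul_mod_right]
  refine ⟨by omega, .inr (.inl ⟨by omega, by omega, ?_⟩)⟩
  unfold cwLabel
  omega

/-- The round distributes m labels in total. For r ≥ 2 they are L' = 1, …, r - 2 followed by L = r -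
1, r + 1, …, 2m + 1 - r; for r = 1 they are the even numbers up to 2m. -/
theorem le_card_add_card_odd {m r : ℕ} (hr : 0 < r) (hrm : r ≤ m) :
    m ≤ (generatorLabels (2 * m + 1) r).card + (generatorLabels (2 * m + 1) (2 * m + 1 - r)).card := by
  classical
  refine le_trans ?_ (Finset.card_union_le _ _)
  have hmem : ∀ i < 2 * m + 1, ∀ t, t ∈ generatorLabels (2 * m + 1) i ↔
      posLabel (m + 1 : ℕ) 1 i t := fun i hi t => by
    rw [mem_generatorLabels (by omega) hi, show (2 * m + 1 + 1) / 2 = m + 1 by omega,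
      show (2 * m + 1) % 2 = 1 by omega]
    rfl
  refine le_card_of_injOn (fun k => if k + 2 < r then k + 1 else 2 * k + 3 - r) (fun k hk => ?_)
    fun k _ l _ h => by split_ifs at h <;> omega
  rw [Finset.mem_union, hmem _ (by omega), hmem _ (by omega)]
  generalize ht : (if k + 2 < r then k + 1 else 2 * k + 3 - r) = t
  have ht' : (k + 2 < r ∧ t = k + 1) ∨ (r ≤ k + 2 ∧ t + r = 2 * k + 3) := by
    split_ifs at ht <;> omega
  clear ht
  by_cases hcw : (t + 2 ≤ r ∧ t % 2 = r % 2) ∨ (r + 1 ≤ t ∧ (t - r - 1) % 4 = 0)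
  · refine .inl ⟨by omega, .inr (.inl ⟨by omega, by omega, ?_⟩)⟩
    unfold cwLabel; omega
  · refine .inr ⟨by omega, .inr (.inr (.inr (.inl ⟨by omega, ?_⟩)))⟩
    unfold ccwLabel; omega

/-- Each summand is M for even r and M - 1 for odd r; the added term counts the odd ones. -/
theorem sum_sub_mod_two (M k : ℕ) (hk : k < M) :
    ∑ r ∈ Finset.range k, (M - (r + 1) + 2 * ((r + 1) / 2)) + (k + 1) / 2 = k * M := by
  induction k with
  | zero => simp
  | succ k ih =>
    have := ih (by omega)
    rw [Finset.sum_range_succ, add_mul k 1 M, one_mul]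
    omega

/-- Pair edge r with edge c - r. For c = 2M the pairs give M(M - 1) - ⌊M/2⌋, edge 0 gives M and edge
M gives ⌊M/2⌋ + 1. For c = 2m + 1 the pairs give m² and edge 0 gives m + 1. -/
theorem sq_le_sum_card_generatorLabels {c : ℕ} (hc : 3 ≤ c) :
    c ^ 2 ≤ 4 * ∑ i ∈ Finset.range c, (generatorLabels c i).card := by
  have h0 := le_card_generatorLabels_zero hc
  rcases Nat.even_or_odd' c with ⟨M, rfl | rfl⟩
  · obtain ⟨N, rfl⟩ : ∃ N, M = N + 1 := ⟨M - 1, by omega⟩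
    have hmid := le_card_even (M := N + 1) (by omega)
    have hpair : ∑ r ∈ Finset.range N, (N + 1 - (r + 1) + 2 * ((r + 1) / 2)) ≤
        ∑ r ∈ Finset.range N, ((generatorLabels (2 * (N + 1)) (r + 1)).card +
          (generatorLabels (2 * (N + 1)) (2 * (N + 1) - (r + 1))).card) :=
      Finset.sum_le_sum fun r hr => by
        have := Finset.mem_range.1 hr
        exact le_card_add_card_even (by omega) (by omega)
    have hsum := sum_sub_mod_two (N + 1) N (by omega)
    have hrefl : ∑ r ∈ Finset.range N, (generatorLabels (2 * (N + 1)) (2 * (N + 1) - (r + 1))).card =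
        ∑ r ∈ Finset.range N, (generatorLabels (2 * (N + 1)) (N + 1 + (r + 1))).card := by
      rw [← Finset.sum_range_reflect]
      refine Finset.sum_congr rfl fun r hr => ?_
      have := Finset.mem_range.1 hr
      congr 2
      omega
    have htot : ∑ i ∈ Finset.range (2 * (N + 1)), (generatorLabels (2 * (N + 1)) i).card =
        ∑ i ∈ Finset.range (N + 1 + (N + 1)), (generatorLabels (2 * (N + 1)) i).card := by
      rw [two_mul]
    rw [Finset.sum_add_distrib (g := fun r => (generatorLabels (2 * (N + 1))
      (2 * (N + 1) - (r + 1))).card), hrefl] at hpair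
    rw [htot, Finset.sum_range_add, Finset.sum_range_succ', Finset.sum_range_succ' _ N, add_zero]
    have : (2 * (N + 1)) ^ 2 = 4 * (N * (N + 1) + N + 1) := by ring
    omega
  · have hpair : ∑ r ∈ Finset.range M, M ≤
        ∑ r ∈ Finset.range M, ((generatorLabels (2 * M + 1) (r + 1)).card +
          (generatorLabels (2 * M + 1) (2 * M + 1 - (r + 1))).card) :=
      Finset.sum_le_sum fun r hr => by
        have := Finset.mem_range.1 hr
        exact le_card_add_card_odd (by omega) (by omega)
    have hrefl : ∑ r ∈ Finset.range M, (generatorLabels (2 * M + 1) (2 * M + 1 - (r + 1))).card =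
        ∑ r ∈ Finset.range M, (generatorLabels (2 * M + 1) (M + 1 + r)).card := by
      rw [← Finset.sum_range_reflect]
      refine Finset.sum_congr rfl fun r hr => ?_
      have := Finset.mem_range.1 hr
      congr 2
      omega
    have htot : ∑ i ∈ Finset.range (2 * M + 1), (generatorLabels (2 * M + 1) i).card =
        ∑ i ∈ Finset.range (M + 1 + M), (generatorLabels (2 * M + 1) i).card := by
      congr 2
      omega
    rw [Finset.sum_add_distrib, hrefl, Finset.sum_const, Finset.card_range, smul_eq_mul] at hpair
    rw [htot, Finset.sum_range_add, Finset.sum_range_succ']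
    have : (2 * M + 1) ^ 2 = 4 * (M * M + M) + 1 := by ring
    omega

end GeneratorLabels

end TemporalGraph

namespace TemporalGraph

open SimpleGraph

/-! ### Parents in trees and cycles in cacti -/

section Tree

variable {V : Type*}

/-- The parents of the vertices in a tree rooted at `p`. -/
theorem exists_parent {T : SimpleGraph V} (hT : T.IsTree) (p : V) : ∃ par : V → V,
    (∀ v, v ≠ p → T.Adj v (par v) ∧ T.dist p (par v) < T.dist p v) ∧
    ∀ v e, IsEdgeTowards T p v e ↔ v ≠ p ∧ e = s(v, par v) := by
  choose q hq hlen using fun v => hT.connected.exists_path_of_dist v p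
  have hnil : ∀ v, v ≠ p → ¬ (q v).Nil := fun v hv h => hv h.eq
  refine ⟨fun v => (q v).snd, fun v hv => ⟨Walk.adj_snd (hnil v hv), ?_⟩, fun v e => ?_⟩
  · have h1 := T.dist_le (q v).tail
    have h2 := Walk.length_tail_add_one (hnil v hv)
    have h3 := hlen v
    have h4 : T.dist p (q v).snd = T.dist (q v).snd p := dist_comm
    have h5 : T.dist p v = T.dist v p := dist_comm
    beta_reduce
    omega
  · have hhead : v ≠ p → (q v).edges.head? = some s(v, (q v).snd) := by
      intro hv
      rw [Walk.mk_start_snd_eq_head_edges (hnil v hv)]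
      exact List.head?_eq_some_head _
    constructor
    · rintro ⟨q', hq', he⟩
      obtain rfl : q' = q v := (hT.existsUnique_path v p).unique hq' (hq v)
      have hv : v ≠ p := by
        rintro rfl
        have := Walk.edges_eq_nil.2 (Walk.isPath_iff_nil.1 (hq v))
        rw [this] at he
        simp at he
      rw [hhead hv] at he
      exact ⟨hv, (Option.some.inj he).symm⟩
    · rintro ⟨hv, rfl⟩
      exact ⟨q v, hq v, hhead hv⟩

/-- A vertex off a cycle of a cactus has at most one neighbour on the cycle. -/
theorem IsCactus.eq_of_adj {G : SimpleGraph V} (hG : IsCactus G) {r : V} {C : G.Walk r r}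
    (hC : C.IsCycle) {v y z : V} (hv : v ∉ C.support) (hy : y ∈ C.support) (hz : z ∈ C.support)
    (hvy : G.Adj v y) (hvz : G.Adj v z) : y = z := by
  classical
  by_contra hne
  have hz' : z ∈ (C.rotate y hy).support := by rwa [Walk.mem_support_rotate_iff]
  have hv' : v ∉ (C.rotate y hy).support := by rwa [Walk.mem_support_rotate_iff]
  have hC' : (C.rotate y hy).IsCycle := hC.rotate hy
  generalize C.rotate y hy = D at *
  let p := D.takeUntil z hz'
  have hp : p.IsPath := hC'.isPath_takeUntil hz'
  have hvp : v ∉ p.support := fun h => hv' (D.support_takeUntil_subset_support hz' h)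
  -- An arc of the cycle from y to z, closed up through v, is a second cycle sharing the first edge
  -- of the arc; it would have the same edges as the first, which avoids v.
  have hq : (Walk.cons hvy (p.concat hvz.symm)).IsCycle := by
    rw [Walk.cons_isCycle_iff]
    refine ⟨hp.concat hvp hvz.symm, fun h => ?_⟩
    rw [Walk.edges_concat, List.concat_eq_append, List.mem_append, List.mem_singleton] at h
    rcases h with h | h
    · exact hvp (p.fst_mem_support_of_mem_edges h)
    · rw [Sym2.eq_swap, Sym2.congr_left] at h
      exact hne h
  have hpn : ¬ p.Nil := fun h => hne h.eq
  have h1 := p.mk_start_snd_mem_edges hpn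
  have h2 := (hG.2 _ _ D _ hC' hq s(y, p.snd) (D.edges_takeUntil_subset_edges hz' h1)
    (by rw [Walk.edges_cons, Walk.edges_concat]; simp [h1]) s(v, y)).2 (by simp)
  exact hv' (D.fst_mem_support_of_mem_edges h2)

theorem _root_.SimpleGraph.Walk.IsCycle.card_support {G : SimpleGraph V} {r : V} {C : G.Walk r r}
    (hC : C.IsCycle) : {v | v ∈ C.support}.ncard = C.length := by
  classical
  have h : {v | v ∈ C.support} = (C.support.tail.toFinset : Set V) := by
    ext v
    simp only [Set.mem_ofPred_eq, List.coe_toFinset]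
    constructor
    · intro hv
      rcases (Walk.mem_support_iff C).1 hv with rfl | hv
      · exact Walk.end_mem_tail_support hC.not_nil
      · exact hv
    · exact fun hv => List.mem_of_mem_tail hv
  rw [h, Set.ncard_coe_finset, List.toFinset_card_of_nodup hC.support_nodup]
  simp

end Tree

/-! ### The vertices and edges of a cycle indexed by the integers -/

section CycleWalk

variable {V : Type*} {G : SimpleGraph V} {r : V}

/-- The vertices of a closed walk, numbered by the integers. -/
def cycleVert (C : G.Walk r r) (k : ℤ) : V := C.getVert (k % C.length).toNat

theorem cycleVert_mem_support (C : G.Walk r r) (k : ℤ) : cycleVert C k ∈ C.support :=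
  C.getVert_mem_support _

theorem cycleVert_natCast {C : G.Walk r r} {i : ℕ} (hi : i ≤ C.length) :
    cycleVert C i = C.getVert i := by
  unfold cycleVert
  rcases hi.lt_or_eq with h | rfl
  · rw [Int.emod_eq_of_lt (by omega) (by omega), Int.toNat_natCast]
  · simp

theorem exists_cycleVert_eq {C : G.Walk r r} {v : V} (hv : v ∈ C.support) :
    ∃ k, cycleVert C k = v := by
  obtain ⟨i, rfl, hi⟩ := Walk.mem_support_iff_exists_getVert.1 hv
  exact ⟨i, cycleVert_natCast hi⟩

theorem cycleVert_eq_iff {C : G.Walk r r} (hC : C.IsCycle) (x y : ℤ) :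
    cycleVert C x = cycleVert C y ↔ (C.length : ℤ) ∣ x - y := by
  have h3 := hC.three_le_length
  have h0 : ∀ z : ℤ, 0 ≤ z % C.length ∧ z % C.length < C.length := fun z =>
    ⟨Int.emod_nonneg _ (by omega), Int.emod_lt_of_pos _ (by omega)⟩
  constructor
  · intro h
    have hx := h0 x
    have hy := h0 y
    have := hC.getVert_injOn' (show (x % C.length).toNat ≤ C.length - 1 by omega)
      (show (y % C.length).toNat ≤ C.length - 1 by omega) h
    exact Int.dvd_of_emod_eq_zero (Int.emod_eq_emod_iff_emod_sub_eq_zero.1 (by omega))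
  · intro h
    unfold cycleVert
    rw [Int.emod_eq_emod_iff_emod_sub_eq_zero.2 (Int.emod_eq_zero_of_dvd h)]

theorem getElem?_edges_iff (C : G.Walk r r) (i : ℕ) (e : Sym2 V) :
    C.edges[i]? = some e ↔ i < C.length ∧ e = s(C.getVert i, C.getVert (i + 1)) := by
  rw [List.getElem?_eq_some_iff]
  constructor
  · rintro ⟨h, rfl⟩
    exact ⟨by simpa using h, Walk.getElem_edges h⟩
  · rintro ⟨h, rfl⟩
    exact ⟨by simpa using h, Walk.getElem_edges _⟩

theorem exists_getElem?_edges_iff {C : G.Walk r r} (hC : C.IsCycle) (x y : V) (t : ℕ) :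
    (∃ i, C.edges[i]? = some s(x, y) ∧ t ∈ generatorLabels C.length i) ↔
      cycleRel (cycleVert C) (generatorAt C.length) x y t := by
  have h3 := hC.three_le_length
  constructor
  · rintro ⟨i, hi, ht⟩
    obtain ⟨hlt, he⟩ := (getElem?_edges_iff C i _).1 hi
    refine ⟨i, ?_, ?_⟩
    · unfold generatorAt
      rwa [Int.emod_eq_of_lt (by omega) (by omega), Int.toNat_natCast]
    · rw [cycleVert_natCast hlt.le, show (i : ℤ) + 1 = (i + 1 : ℕ) by simp, cycleVert_natCast hlt]
      exact Sym2.eq_iff.1 he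
  · rintro ⟨k, hk, hxy⟩
    have h0 := Int.emod_nonneg k (show (C.length : ℤ) ≠ 0 by omega)
    have hlt := Int.emod_lt_of_pos k (show (0 : ℤ) < C.length by omega)
    have hmod : (C.length : ℤ) ∣ k - k % C.length := Int.dvd_self_sub_emod
    obtain ⟨i, hi⟩ := Int.eq_ofNat_of_zero_le h0
    have h1 : cycleVert C k = C.getVert i := by
      rw [(cycleVert_eq_iff hC k (k % C.length)).2 hmod, hi, cycleVert_natCast (by omega)]
    have h2 : cycleVert C (k + 1) = C.getVert (i + 1) := by
      rw [(cycleVert_eq_iff hC (k + 1) (k % C.length + 1)).2 (by simpa using hmod), hi,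
        show (i : ℤ) + 1 = (i + 1 : ℕ) by simp, cycleVert_natCast (by omega)]
    refine ⟨i, (getElem?_edges_iff C i _).2 ⟨by omega, ?_⟩, ?_⟩
    · rw [← h1, ← h2]
      exact Sym2.eq_iff.2 hxy
    · unfold generatorAt at hk
      rwa [hi, Int.toNat_natCast] at hk

end CycleWalk

section Shift

variable {α : Type*} {R R' : α → α → ℕ → Prop} {u v : α} {s t : ℕ}

theorem TReach.add_time (N : ℕ) (hR : ∀ x y a, R x y a → R' x y (a + N)) (h : TReach R u s v t) :
    TReach R' u (s + N) v (t + N) := by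
  induction h with
  | refl ht => exact .refl (by omega)
  | step _ hr h1 h2 ih => exact .step ih (hR _ _ _ hr) (by omega) (by omega)

theorem TReach.sub_time (N : ℕ) (hR : ∀ x y a, R x y a → N ≤ a ∧ R' x y (a - N))
    (h : TReach R u s v t) : TReach R' u (s - N) v (t - N) := by
  induction h with
  | refl ht => exact .refl (by omega)
  | step _ hr h1 h2 ih =>
    obtain ⟨h3, h4⟩ := hR _ _ _ hr
    exact .step ih h4 (by omega) (by omega)

end Shift

end TemporalGraph

namespace TemporalGraph

open SimpleGraph

/-! ### Cost of a core with a forest -/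

section Cost

variable {V : Type*} [Fintype V] {G : SimpleGraph V} {lam : G.EdgeLabeling (Finset ℕ)} {C : Set V}
  {core : V → V → ℕ → Prop} {up : V → V} {dep f g : V → ℕ} {s₁ s₂ : ℕ}

/-- Two parent edges cannot coincide, because depth strictly decreases towards the parent, and a
parent edge is no core edge, because it has an endpoint off C. -/
theorem IsCoreExtension.add_sum_card_le_temporalCost
    (h : IsCoreExtension (labelRel lam) C core up dep f g s₁ s₂) (k : ℕ) (e : ℕ → Sym2 V)
    (A : ℕ → Finset ℕ) (he : Set.InjOn e (Finset.range k)) (heC : ∀ i < k, ∀ x ∈ e i, x ∈ C)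
    (hA : ∀ i < k, ∀ t ∈ A i, HasLabel lam (e i) t) :
    2 * (Fintype.card V - C.ncard) + ∑ i ∈ Finset.range k, (A i).card ≤ temporalCost lam := by
  classical
  have hcard : (Finset.univ.filter (· ∉ C)).card = Fintype.card V - C.ncard := by
    rw [← Nat.card_eq_fintype_card, ← Set.ncard_compl, Set.ncard_eq_toFinset_card']
    congr 1
    ext x
    simp
  have key := sum_card_le_temporalCost (lam := lam)
    ((Finset.univ.filter (· ∉ C)).disjSum (Finset.range k))
    (Sum.elim (fun v => s(v, up v)) e) (Sum.elim (fun v => {f v, g v}) A) ?_ ?_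
  · rw [Finset.sum_disjSum] at key
    simp only [Sum.elim_inl, Sum.elim_inr] at key
    have h2 : ∑ v ∈ Finset.univ.filter (· ∉ C), ({f v, g v} : Finset ℕ).card =
        2 * (Fintype.card V - C.ncard) := by
      rw [← hcard, Finset.sum_congr rfl fun v hv => Finset.card_pair
        (h.f_lt_g (Finset.mem_filter.1 hv).2 (Finset.mem_filter.1 hv).2).ne, Finset.sum_const,
        smul_eq_mul, mul_comm]
    rwa [h2] at key
  · rintro (v | i) hv (w | j) hw hvw
    · simp only [Finset.mem_coe, Finset.inl_mem_disjSum, Finset.mem_filter] at hv hw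
      rcases Sym2.eq_iff.1 hvw with ⟨rfl, _⟩ | ⟨h1, h2⟩
      · rfl
      · have h3 := h.dep_lt v hv.2
        have h4 := h.dep_lt w hw.2
        rw [h2] at h3
        rw [← h1] at h4
        omega
    · simp only [Finset.mem_coe, Finset.inl_mem_disjSum, Finset.inr_mem_disjSum, Finset.mem_filter,
        Finset.mem_range, Sum.elim_inl, Sum.elim_inr] at hv hw hvw
      exact absurd (heC j hw v (hvw ▸ Sym2.mem_mk_left _ _)) hv.2
    · simp only [Finset.mem_coe, Finset.inl_mem_disjSum, Finset.inr_mem_disjSum, Finset.mem_filter,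
        Finset.mem_range, Sum.elim_inl, Sum.elim_inr] at hv hw hvw
      exact absurd (heC i hv w (hvw ▸ Sym2.mem_mk_left _ _)) hw.2
    · simp only [Finset.mem_coe, Finset.inr_mem_disjSum] at hv hw
      exact congrArg _ (he hv hw hvw)
  · rintro (v | i) hv t ht
    · simp only [Finset.inl_mem_disjSum, Finset.mem_filter] at hv
      simp only [Sum.elim_inl, Finset.mem_insert, Finset.mem_singleton] at ht
      exact (h.rel_iff _ _ _).2 (.inl ⟨hv.2, rfl, ht⟩)
    · simp only [Finset.inr_mem_disjSum, Finset.mem_range] at hv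
      exact hA i hv t ht

end Cost

section Contract

variable {V : Type*} {S : Set V}

theorem contractMap_of_mem {v : V} (hv : v ∈ S) : contractMap S v = none := dif_pos hv

theorem contractMap_of_notMem {v : V} (hv : v ∉ S) : contractMap S v = some ⟨v, hv⟩ := dif_neg hv

theorem contractMap_eq_none {v : V} : contractMap S v = none ↔ v ∈ S := by
  by_cases hv : v ∈ S
  · simp [contractMap_of_mem hv, hv]
  · simp [contractMap_of_notMem hv, hv]

theorem contractMap_inj {v w : V} (hv : v ∉ S) (h : contractMap S v = contractMap S w) : v = w := by
  have hw : w ∉ S := by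
    rw [← contractMap_eq_none, ← h, contractMap_eq_none]
    exact hv
  rw [contractMap_of_notMem hv, contractMap_of_notMem hw] at h
  simpa using h

end Contract

/-! ### The combined labelling around a largest cycle -/

section CycleCombined

variable {V : Type*} [Fintype V] {G : SimpleGraph V}

/-- The labels on a cycle, shifted by `N`. -/
def shiftRel {V : Type*} (R : V → V → ℕ → Prop) (N : ℕ) (x y : V) (t : ℕ) : Prop :=
  ∃ s, R x y s ∧ t = s + N

theorem isCoreExtension_of_contract (hG : IsCactus G) {lam : G.EdgeLabeling (Finset ℕ)} {r : V}
    {C : G.Walk r r} (hC : C.IsCycle) {S : Set V} (hS : S = {v | v ∈ C.support})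
    {T : SimpleGraph (Option {v : V // v ∉ S})}
    (hTG : T ≤ G.map (contractMap S)) (hT : T.IsTree)
    {fst snd : Option {v : V // v ∉ S} → ℕ} (hfst : IsReverseBFSOrder T none fst)
    (hsnd : IsBFSOrder T none snd)
    (hlam : ∀ e t, HasLabel lam e t ↔ e ∈ G.edgeSet ∧
      ((∃ v, IsEdgeTowards T none v (Sym2.map (contractMap S) e) ∧ t = fst v) ∨
      (∃ i, C.edges[i]? = some (e : Sym2 V) ∧ ∃ s ∈ generatorLabels C.length i,
        t = s + (Nat.card V - C.length)) ∨
      (∃ v, IsEdgeTowards T none v (Sym2.map (contractMap S) e) ∧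
        t = (Nat.card V - C.length) + snd v +
          ((Nat.card V - C.length) + generatorMax C.length + 1)))) :
    ∃ up dep f g, IsCoreExtension (labelRel lam) S
      (shiftRel (cycleRel (cycleVert C) (generatorAt C.length)) (Nat.card V - C.length)) up dep f g
      (Nat.card V - C.length + 1) (Nat.card V - C.length + generatorMax C.length + 1) := by
  classical
  obtain ⟨par, hpar, htow⟩ := exists_parent hT none
  have hcard : Nat.card (Option {v : V // v ∉ S}) - 1 = Nat.card V - C.length := by
    have h1 : Nat.card {v : V // v ∉ S} = Sᶜ.ncard := rfl
    rw [Finite.card_option, h1, Set.ncard_compl, hS, hC.card_support]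
    rfl
  have hne : ∀ v, v ∉ S → contractMap S v ≠ none := fun v hv h => hv (contractMap_eq_none.1 h)
  have hex : ∀ v, ∃ y, v ∉ S → G.Adj v y ∧ contractMap S y = par (contractMap S v) := by
    intro v
    by_cases hv : v ∈ S
    · exact ⟨v, fun h => absurd hv h⟩
    · obtain ⟨-, u', y, hadj, hu', hy⟩ := hTG (hpar _ (hne v hv)).1
      obtain rfl : v = u' := contractMap_inj hv hu'.symm
      exact ⟨y, fun _ => ⟨hadj, hy⟩⟩
  choose up hup using hex
  -- The only place where the cactus property enters: an edge of the contracted tree has exactly one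
  -- preimage in the graph, also when it ends at the contracted cycle.
  have huniq : ∀ v y, v ∉ S → G.Adj v y → contractMap S y = par (contractMap S v) → y = up v := by
    intro v y hv hadj hy
    obtain ⟨hadj', hup'⟩ := hup v hv
    by_cases hyS : y ∈ S
    · refine hG.eq_of_adj hC (v := v) (fun h => hv (hS ▸ h)) (hS ▸ hyS : y ∈ {v | v ∈ C.support}) ?_ hadj hadj'
      have : up v ∈ S := by
        rw [← contractMap_eq_none, hup', ← hy, contractMap_eq_none]
        exact hyS
      exact (hS ▸ this : up v ∈ {v | v ∈ C.support})
    · exact contractMap_inj hyS (hy.trans hup'.symm)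
  have htree : ∀ x y v, G.Adj x y → (IsEdgeTowards T none v (Sym2.map (contractMap S) s(x, y)) ↔
      (x ∉ S ∧ y = up x ∧ v = contractMap S x) ∨ (y ∉ S ∧ x = up y ∧ v = contractMap S y)) := by
    intro x y v hadj
    rw [htow, Sym2.map_mk]
    constructor
    · rintro ⟨hv, he⟩
      rcases Sym2.eq_iff.1 he with ⟨h1, h2⟩ | ⟨h1, h2⟩
      · left
        have hx : x ∉ S := fun hx => hv (by rw [← h1, contractMap_of_mem hx])
        exact ⟨hx, huniq x y hx hadj (by rw [h2, h1]), h1.symm⟩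
      · right
        have hy : y ∉ S := fun hy => hv (by rw [← h2, contractMap_of_mem hy])
        exact ⟨hy, huniq y x hy hadj.symm (by rw [h1, h2]), h2.symm⟩
    · rintro (⟨hx, rfl, rfl⟩ | ⟨hy, rfl, rfl⟩)
      · exact ⟨hne x hx, by rw [(hup x hx).2]⟩
      · exact ⟨hne y hy, by rw [(hup y hy).2, Sym2.eq_swap]⟩
  have hfst1 : ∀ v, v ∉ S → fst (contractMap S v) ≤ Nat.card V - C.length := fun v hv => by
    have := (hfst.1.mapsTo (hne v hv)).2
    rwa [hcard] at this
  have hsnd1 : ∀ v, v ∉ S → 1 ≤ snd (contractMap S v) := fun v hv =>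
    (hsnd.1.mapsTo (hne v hv)).1
  have hparlt : ∀ v, v ∉ S →
      T.dist none (contractMap S (up v)) < T.dist none (contractMap S v) := fun v hv => by
    rw [(hup v hv).2]
    exact (hpar _ (hne v hv)).2
  have hedge : ∀ x y t, cycleRel (cycleVert C) (generatorAt C.length) x y t →
      s(x, y) ∈ C.edges := by
    intro x y t h
    obtain ⟨i, hi, -⟩ := (exists_getElem?_edges_iff hC x y t).2 h
    exact List.mem_of_getElem? hi
  refine ⟨up, fun v => T.dist none (contractMap S v), fun v => fst (contractMap S v),
    fun v => (Nat.card V - C.length) + snd (contractMap S v) +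
      ((Nat.card V - C.length) + generatorMax C.length + 1),
    ?_, ?_, ?_, hparlt, ?_, ?_, ?_, ?_, ?_, ?_, ?_, ?_, by omega⟩
  · intro x y t
    have hcore : (∃ i, C.edges[i]? = some s(x, y) ∧ ∃ s ∈ generatorLabels C.length i,
        t = s + (Nat.card V - C.length)) ↔
        shiftRel (cycleRel (cycleVert C) (generatorAt C.length)) (Nat.card V - C.length) x y t := by
      unfold shiftRel
      simp only [← exists_getElem?_edges_iff hC]
      constructor
      · rintro ⟨i, hi, s, hs, rfl⟩
        exact ⟨s, ⟨i, hi, hs⟩, rfl⟩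
      · rintro ⟨s, ⟨i, hi, hs⟩, rfl⟩
        exact ⟨i, hi, s, hs, rfl⟩
    unfold labelRel
    rw [hlam, hcore]
    constructor
    · rintro ⟨hadj, ⟨v, hv, rfl⟩ | hc | ⟨v, hv, rfl⟩⟩
      · rcases (htree x y v hadj).1 hv with ⟨h1, h2, rfl⟩ | ⟨h1, h2, rfl⟩
        · exact .inl ⟨h1, h2, .inl rfl⟩
        · exact .inr (.inl ⟨h1, h2, .inl rfl⟩)
      · exact .inr (.inr hc)
      · rcases (htree x y v hadj).1 hv with ⟨h1, h2, rfl⟩ | ⟨h1, h2, rfl⟩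
        · exact .inl ⟨h1, h2, .inr rfl⟩
        · exact .inr (.inl ⟨h1, h2, .inr rfl⟩)
    · rintro (⟨hx, rfl, ht⟩ | ⟨hy, rfl, ht⟩ | hc)
      · have hadj := (hup x hx).1
        refine ⟨hadj, ?_⟩
        have := (htree x _ _ hadj).2 (.inl ⟨hx, rfl, rfl⟩)
        rcases ht with rfl | rfl
        · exact .inl ⟨_, this, rfl⟩
        · exact .inr (.inr ⟨_, this, rfl⟩)
      · have hadj := (hup y hy).1.symm
        refine ⟨hadj, ?_⟩
        have := (htree _ y _ hadj).2 (.inr ⟨hy, rfl, rfl⟩)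
        rcases ht with rfl | rfl
        · exact .inl ⟨_, this, rfl⟩
        · exact .inr (.inr ⟨_, this, rfl⟩)
      · obtain ⟨s, hs, -⟩ := id hc
        exact ⟨C.edges_subset_edgeSet (hedge _ _ _ hs), .inr (.inl hc)⟩
  · rintro x y t ⟨s, hs, rfl⟩
    exact ⟨s, cycleRel_symm hs, rfl⟩
  · rintro x y t ⟨s, hs, rfl⟩
    exact hS ▸ C.fst_mem_support_of_mem_edges (hedge _ _ _ hs)
  · intro x hx hxu
    exact hfst.2 _ _ (hne x hx) (hne _ hxu) (hparlt x hx)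
  · intro x hx hxu
    have := hsnd.2 _ _ (hne _ hxu) (hne x hx) (hparlt x hx)
    omega
  · intro x y hx hy hxy
    exact contractMap_inj hx (hfst.1.injOn (hne x hx) (hne y hy) hxy)
  · intro x y hx hy hxy
    exact contractMap_inj hx (hsnd.1.injOn (hne x hx) (hne y hy) (by omega))
  · intro x hx
    have := hfst1 x hx
    omega
  · rintro x y t ⟨s, ⟨k, hk, -⟩, rfl⟩
    have h3 := hC.three_le_length
    have := Int.emod_lt_of_pos k (show (0 : ℤ) < C.length by omega)
    have := Int.emod_nonneg k (show (C.length : ℤ) ≠ 0 by omega)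
    have := ((mem_generatorLabels h3 (by omega)).1 hk).1
    omega
  · rintro x y t ⟨s, ⟨k, hk, -⟩, rfl⟩
    have h3 := hC.three_le_length
    have := Int.emod_lt_of_pos k (show (0 : ℤ) < C.length by omega)
    have := Int.emod_nonneg k (show (C.length : ℤ) ≠ 0 by omega)
    have := le_generatorMax (by omega) hk
    omega
  · intro x hx
    have := hsnd1 x hx
    omega

/-- The properties that the combined labellings share. -/
structure IsExtremalLabelling (lam : G.EdgeLabeling (Finset ℕ)) (c : ℕ) : Prop where
  proper : IsProper lam
  minimal : IsMinimal lam
  connected : IsTemporallyConnected lam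
  le_card : c ≤ Fintype.card V
  le_cost : c ^ 2 + 8 * (Fintype.card V - c) ≤ 4 * temporalCost lam
  le_temporality : (c + 1) / 2 ≤ temporality lam

theorem IsCycleCombinedLabelling.isExtremalLabelling (hG : IsCactus G)
    {lam : G.EdgeLabeling (Finset ℕ)} (h : IsCycleCombinedLabelling lam) :
    IsExtremalLabelling lam (circumference G) := by
  classical
  obtain ⟨r, C, hC, hlen, T, hTG, hT, fst, snd, hfst, hsnd, hlam⟩ := h
  rw [← hlen] at hlam ⊢
  have h3 := hC.three_le_length
  have hlam' : ∀ e t, HasLabel lam e t ↔ e ∈ G.edgeSet ∧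
      ((∃ v, IsEdgeTowards T none v (Sym2.map (contractMap {v | v ∈ C.support}) e) ∧ t = fst v) ∨
      (∃ i, C.edges[i]? = some e ∧ ∃ s ∈ generatorLabels C.length i,
        t = s + (Nat.card V - C.length)) ∨
      (∃ v, IsEdgeTowards T none v (Sym2.map (contractMap {v | v ∈ C.support}) e) ∧
        t = (Nat.card V - C.length) + snd v +
          ((Nat.card V - C.length) + generatorMax C.length + 1))) :=
    fun e t => ⟨fun ⟨he, ht⟩ => ⟨he, (hlam ⟨e, he⟩ t).1 ht⟩,
      fun ⟨he, ht⟩ => ⟨he, (hlam ⟨e, he⟩ t).2 ht⟩⟩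
  obtain ⟨up, dep, f, g, hcore⟩ := isCoreExtension_of_contract hG hC rfl hTG hT hfst hsnd hlam'
  set N := Nat.card V - C.length with hN
  have hgen := isGeneratorLabels_generatorAt h3
  have hw := cycleVert_eq_iff hC
  have hconn : IsTemporallyConnected lam := by
    intro u v
    refine reaches_iff.2 (hcore.exists_treach ?_ u v)
    intro x hx y hy
    obtain ⟨a, rfl⟩ := exists_cycleVert_eq hx
    obtain ⟨b, rfl⟩ := exists_cycleVert_eq hy
    obtain ⟨t, ht⟩ := hgen.exists_treach hw a b
    exact ⟨_, (ht.add_time N fun x y s hs => ⟨s, hs, rfl⟩).of_le (Nat.zero_le _)⟩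
  have hsub : C.length ≤ Fintype.card V := by
    rw [← hC.card_support, ← Nat.card_eq_fintype_card]
    exact Set.ncard_le_card _
  have hlab : ∀ i < C.length, ∀ t ∈ (generatorLabels C.length i).image (· + N),
      HasLabel lam s(C.getVert i, C.getVert (i + 1)) t := by
    intro i hi t ht
    obtain ⟨s, hs, rfl⟩ := Finset.mem_image.1 ht
    have hadj : G.Adj (C.getVert i) (C.getVert (i + 1)) := C.adj_getVert_succ hi
    exact (hlam' _ _).2 ⟨hadj, .inr (.inl ⟨i, (getElem?_edges_iff C i _).2 ⟨hi, rfl⟩, s, hs, rfl⟩)⟩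
  have hcardim : ∀ i, ((generatorLabels C.length i).image (· + N)).card =
      (generatorLabels C.length i).card :=
    fun i => Finset.card_image_of_injective _ (add_left_injective N)
  refine ⟨?_, ?_, hconn, hsub, ?_, ?_⟩
  · rw [isProper_iff]
    intro x y z t h1 h2
    refine hcore.rel_unique ?_ h1 h2
    rintro x y z t ⟨s, hs, rfl⟩ ⟨s', hs', heq⟩
    obtain rfl : s = s' := by omega
    exact hgen.cycleRel_unique hw hs hs'
  · refine hconn.isMinimal (hcore.exists_not_treach ?_ ?_)
    · rw [← Set.one_lt_ncard_iff_nontrivial, hC.card_support]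
      omega
    · rintro x y _ ⟨t₀, h₀, rfl⟩
      obtain ⟨a, b, hab⟩ := hgen.exists_not_treach hw h₀
      -- A core walk with the label erased is moved back by N; all its labels are at least N, so the
      -- subtraction loses nothing.
      refine ⟨_, cycleVert_mem_support C a, _, cycleVert_mem_support C b, fun t ht => ?_⟩
      refine hab (t - N) ((ht.sub_time N ?_).of_le (Nat.zero_le _))
      rintro p q a ⟨⟨s, hs, rfl⟩, hne⟩
      refine ⟨by omega, ?_⟩
      rw [Nat.add_sub_cancel]
      exact ⟨hs, fun h => hne ⟨h.1, by rw [h.2]⟩⟩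
  · have key := hcore.add_sum_card_le_temporalCost C.length
      (fun i => s(C.getVert i, C.getVert (i + 1)))
      (fun i => (generatorLabels C.length i).image (· + N)) ?_ ?_ hlab
    · simp only [hcardim, hC.card_support] at key
      have := sq_le_sum_card_generatorLabels h3
      omega
    · intro i hi j hj hij
      simp only [Finset.coe_range, Set.mem_Iio] at hi hj
      have h1 := (getElem?_edges_iff C i _).2 ⟨hi, rfl⟩
      have h2 := (getElem?_edges_iff C j _).2 ⟨hj, rfl⟩
      simp only at hij
      rw [hij, ← h2] at h1
      exact (List.getElem?_inj (by simpa using hi) hC.isCircuit.isTrail.edges_nodup).1 h1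
    · rintro i hi x hx
      rcases Sym2.mem_iff.1 hx with rfl | rfl <;> exact C.getVert_mem_support _
  · have hadj : G.Adj (C.getVert 0) (C.getVert (0 + 1)) := C.adj_getVert_succ (by omega)
    have := card_le_temporality (e := s(C.getVert 0, C.getVert (0 + 1))) hadj (hlab 0 (by omega))
    rw [hcardim] at this
    exact (le_card_generatorLabels_zero h3).trans this

end CycleCombined

end TemporalGraph

namespace TemporalGraph

open SimpleGraph

/-! ### The pivot labelling of a tree -/

section Pivot

variable {V : Type*} [Fintype V] [Nontrivial V] {G : SimpleGraph V}

/-- The last vertex v' of the first pass is adjacent to p, and its label n - 1 separates the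
remaining labels of the two passes. Since its second label is removed, the edge {p, v'} is a core
with one label. -/
theorem isCoreExtension_of_pivot (hG : G.IsTree) {lam : G.EdgeLabeling (Finset ℕ)}
    (h : IsPivotLabelling lam) : ∃ p v' : V, p ≠ v' ∧ ∃ up dep f g,
      IsCoreExtension (labelRel lam) {p, v'}
        (fun x y t => s(x, y) = s(p, v') ∧ t = Nat.card V - 1) up dep f g
        (Nat.card V - 1) (Nat.card V) := by
  obtain ⟨p, fst, snd, hfst, hsnd, hlam⟩ := h
  obtain ⟨par, hpar, htow⟩ := exists_parent hG p
  have hn : 1 < Nat.card V := Finite.one_lt_card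
  obtain ⟨v', hv', hv'n⟩ := hfst.1.surjOn (show Nat.card V - 1 ∈ Set.Icc 1 (Nat.card V - 1) from
    ⟨by omega, le_rfl⟩)
  replace hv' : v' ≠ p := hv'
  -- A parent other than p would come after v' in the first pass.
  have hparv' : par v' = p := by
    by_contra hne
    have h1 := hfst.2 _ _ hv' hne (hpar v' hv').2
    have h2 := (hfst.1.mapsTo (show par v' ∈ {v | v ≠ p} from hne)).2
    omega
  have hne : ∀ x, x ∉ ({p, v'} : Set V) → x ≠ p ∧ x ≠ v' := fun x hx => by simpa using hx
  have hfst1 : ∀ x, x ≠ p → fst x = Nat.card V - 1 → x = v' := fun x hx h =>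
    hfst.1.injOn hx hv' (h.trans hv'n.symm)
  have hlam' : ∀ x y t, labelRel lam x y t ↔ G.Adj x y ∧
      ((∃ v, (v ≠ p ∧ s(x, y) = s(v, par v)) ∧ t = fst v) ∨
      (∃ v, (v ≠ p ∧ s(x, y) = s(v, par v)) ∧ fst v ≠ Nat.card V - 1 ∧
        t = (Nat.card V - 1) + snd v)) := by
    intro x y t
    simp only [← htow]
    exact ⟨fun ⟨h, ht⟩ => ⟨h, (hlam ⟨_, h⟩ t).1 ht⟩, fun ⟨h, ht⟩ => ⟨h, (hlam ⟨_, h⟩ t).2 ht⟩⟩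
  refine ⟨p, v', hv'.symm, par, G.dist p, fst, fun v => (Nat.card V - 1) + snd v, ?_, ?_, ?_,
    fun x hx => (hpar x (hne x hx).1).2, ?_, ?_, ?_, ?_, ?_, ?_, ?_, ?_, by omega⟩
  · intro x y t
    rw [hlam']
    constructor
    · have key : ∀ v, v ≠ p → s(x, y) = s(v, par v) → v ≠ v' → (t = fst v ∨
          t = (Nat.card V - 1) + snd v) → (x ∉ ({p, v'} : Set V) ∧ y = par x ∧ (t = fst x ∨
          t = (Nat.card V - 1) + snd x)) ∨ (y ∉ ({p, v'} : Set V) ∧ x = par y ∧ (t = fst y ∨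
          t = (Nat.card V - 1) + snd y)) := by
        intro v hv he hvv' ht
        rcases Sym2.eq_iff.1 he with ⟨rfl, rfl⟩ | ⟨rfl, rfl⟩
        · exact .inl ⟨by simp [hv, hvv'], rfl, ht⟩
        · exact .inr ⟨by simp [hv, hvv'], rfl, ht⟩
      rintro ⟨-, ⟨v, ⟨hv, he⟩, ht⟩ | ⟨v, ⟨hv, he⟩, hf, ht⟩⟩
      · by_cases hvv' : v = v'
        · subst hvv'
          exact .inr (.inr ⟨by rw [he, hparv', Sym2.eq_swap], ht.trans hv'n⟩)
        · exact or_assoc.1 (.inl (key v hv he hvv' (.inl ht)))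
      · exact or_assoc.1 (.inl (key v hv he (fun h => hf (h ▸ hv'n)) (.inr ht)))
    · have key : ∀ v, v ∉ ({p, v'} : Set V) → (t = fst v ∨ t = (Nat.card V - 1) + snd v) →
          s(x, y) = s(v, par v) → (∃ v, (v ≠ p ∧ s(x, y) = s(v, par v)) ∧ t = fst v) ∨
          (∃ v, (v ≠ p ∧ s(x, y) = s(v, par v)) ∧ fst v ≠ Nat.card V - 1 ∧
          t = (Nat.card V - 1) + snd v) := by
        intro v hv ht he
        obtain ⟨h1, h2⟩ := hne v hv
        rcases ht with ht | ht
        · exact .inl ⟨v, ⟨h1, he⟩, ht⟩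
        · exact .inr ⟨v, ⟨h1, he⟩, fun h => h2 (hfst1 v h1 h), ht⟩
      rintro (⟨hx, rfl, ht⟩ | ⟨hy, rfl, ht⟩ | ⟨he, ht⟩)
      · exact ⟨(hpar x (hne x hx).1).1, key x hx ht rfl⟩
      · exact ⟨(hpar y (hne y hy).1).1.symm, key y hy ht Sym2.eq_swap⟩
      · have he' : s(x, y) = s(v', par v') := by rw [he, hparv', Sym2.eq_swap]
        refine ⟨?_, .inl ⟨v', ⟨hv', he'⟩, ht.trans hv'n.symm⟩⟩
        rw [← mem_edgeSet, he']
        exact (hpar v' hv').1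
  · rintro x y t ⟨he, ht⟩
    exact ⟨by rw [Sym2.eq_swap, he], ht⟩
  · rintro x y t ⟨he, -⟩
    rcases Sym2.eq_iff.1 he with ⟨rfl, -⟩ | ⟨rfl, -⟩ <;> simp
  · intro x hx hxu
    exact hfst.2 _ _ (hne x hx).1 (hne _ hxu).1 (hpar x (hne x hx).1).2
  · intro x hx hxu
    have := hsnd.2 _ _ (hne _ hxu).1 (hne x hx).1 (hpar x (hne x hx).1).2
    omega
  · intro x y hx hy hxy
    exact hfst.1.injOn (hne x hx).1 (hne y hy).1 hxy
  · intro x y hx hy hxy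
    exact hsnd.1.injOn (hne x hx).1 (hne y hy).1 (by omega)
  · intro x hx
    have h1 := (hfst.1.mapsTo (show x ∈ {v | v ≠ p} from (hne x hx).1)).2
    have h2 : fst x ≠ Nat.card V - 1 := fun h => (hne x hx).2 (hfst1 x (hne x hx).1 h)
    omega
  · rintro x y t ⟨-, rfl⟩
    exact le_rfl
  · rintro x y t ⟨-, rfl⟩
    omega
  · intro x hx
    have h1 : 1 ≤ snd x := (hsnd.1.mapsTo (show x ∈ {v | v ≠ p} from (hne x hx).1)).1
    omega

theorem IsPivotLabelling.isExtremalLabelling (hG : G.IsTree) {lam : G.EdgeLabeling (Finset ℕ)}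
    (h : IsPivotLabelling lam) : IsExtremalLabelling lam 2 := by
  classical
  obtain ⟨p, v', hpv, up, dep, f, g, hcore⟩ := isCoreExtension_of_pivot hG h
  set N := Nat.card V - 1
  have hlab : HasLabel lam s(p, v') N := (hcore.rel_iff p v' N).2 (.inr (.inr ⟨rfl, rfl⟩))
  have hconn : IsTemporallyConnected lam := by
    intro u v
    refine reaches_iff.2 (hcore.exists_treach ?_ u v)
    rintro x (rfl | rfl) y (rfl | rfl)
    · exact ⟨0, .refl le_rfl⟩
    · exact ⟨_, (TReach.single ⟨rfl, rfl⟩).of_le (Nat.zero_le _)⟩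
    · exact ⟨_, (TReach.single ⟨Sym2.eq_swap, rfl⟩).of_le (Nat.zero_le _)⟩
    · exact ⟨0, .refl le_rfl⟩
  have hn : 1 < Fintype.card V := Fintype.one_lt_card
  refine ⟨?_, ?_, hconn, hn, ?_, ?_⟩
  · rw [isProper_iff]
    intro x y z t h1 h2
    refine hcore.rel_unique ?_ h1 h2
    rintro x y z t ⟨h1, -⟩ ⟨h2, -⟩
    exact Sym2.congr_right.1 (h1.trans h2.symm)
  · refine hconn.isMinimal (hcore.exists_not_treach (Set.nontrivial_pair hpv) ?_)
    rintro x y t₀ ⟨h1, rfl⟩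
    refine ⟨p, by simp, v', by simp, fun t ht => hpv.symm ?_⟩
    refine ht.invariant (fun _ x => x = p) rfl (fun _ _ _ _ h => h) ?_
    rintro a x y - ⟨⟨h2, rfl⟩, h3⟩
    exact absurd ⟨h2.trans h1.symm, rfl⟩ h3
  · have key := hcore.add_sum_card_le_temporalCost 1 (fun _ => s(p, v')) (fun _ => {N}) ?_ ?_ ?_
    · rw [Set.ncard_pair hpv] at key
      simp only [Finset.range_one, Finset.card_singleton, Finset.sum_const, smul_eq_mul] at key
      omega
    · intro i hi j hj _
      simp only [Finset.range_one, Finset.coe_singleton, Set.mem_singleton_iff] at hi hj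
      omega
    · intro i _ x hx
      simpa using hx
    · intro i _ t ht
      rw [Finset.mem_singleton.1 ht]
      exact hlab
  · have := card_le_temporality (lam := lam) (e := s(p, v')) hlab.1 (A := {N})
      (fun t ht => by rw [Finset.mem_singleton.1 ht]; exact hlab)
    simpa using this

end Pivot

end TemporalGraph

namespace TemporalGraph

open SimpleGraph

/-! ### Existence of combined labellings -/

section Existence

theorem exists_bijOn_of_key {V α : Type*} [Finite V] [LinearOrder α] (p : V) (key : V → α) :
    ∃ pos : V → ℕ, Set.BijOn pos {v | v ≠ p} (Set.Icc 1 (Nat.card V - 1)) ∧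
      ∀ u v, u ≠ p → v ≠ p → key u < key v → pos u < pos v := by
  classical
  have := Fintype.ofFinite V
  have hcard : Nat.card {v // v ≠ p} = Nat.card V - 1 := by
    simp
  let e : {v // v ≠ p} ≃ Fin (Nat.card V - 1) := Finite.equivFinOfCardEq hcard
  let σ := Tuple.sort fun i => key (e.symm i)
  let ψ : {v // v ≠ p} ≃ Fin (Nat.card V - 1) := e.trans σ.symm
  have hmono : ∀ u v : {v // v ≠ p}, key u < key v → ψ u < ψ v := by
    intro u v huv
    by_contra hle
    have := Tuple.monotone_sort (fun i => key (e.symm i)) (not_lt.1 hle)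
    have h2 : ∀ w : {v // v ≠ p}, e.symm (σ (ψ w)) = w := fun w => by simp [ψ]
    simp only [Function.comp_apply] at this
    change key (e.symm (σ (ψ v))) ≤ key (e.symm (σ (ψ u))) at this
    rw [h2, h2] at this
    exact absurd huv this.not_gt
  refine ⟨fun v => if h : v ≠ p then (ψ ⟨v, h⟩ : ℕ) + 1 else 0, ⟨?_, ?_, ?_⟩, ?_⟩
  · intro v hv
    have hv' : v ≠ p := hv
    simp only [hv', ne_eq, not_false_eq_true, dif_pos, Set.mem_Icc]
    have := (ψ ⟨v, hv'⟩).isLt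
    omega
  · intro u hu v hv huv
    have hu' : u ≠ p := hu
    have hv' : v ≠ p := hv
    simp only [hu', hv', ne_eq, not_false_eq_true, dif_pos, add_left_inj] at huv
    exact congrArg Subtype.val (ψ.injective (Fin.ext huv))
  · rintro k ⟨hk1, hk2⟩
    refine ⟨ψ.symm ⟨k - 1, by omega⟩, (ψ.symm _).2, ?_⟩
    have := (ψ.symm ⟨k - 1, by omega⟩).2
    simp only [this, ne_eq, not_false_eq_true, dif_pos, Subtype.coe_eta, Equiv.apply_symm_apply]
    omega
  · intro u v hu hv huv
    simp only [hu, hv, ne_eq, not_false_eq_true, dif_pos]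
    have := hmono ⟨u, hu⟩ ⟨v, hv⟩ huv
    omega

theorem exists_isReverseBFSOrder {V : Type*} [Finite V] (T : SimpleGraph V) (p : V) :
    ∃ pos, IsReverseBFSOrder T p pos := by
  obtain ⟨pos, h1, h2⟩ := exists_bijOn_of_key p fun v => OrderDual.toDual (T.dist p v)
  exact ⟨pos, h1, fun u v hu hv h => h2 u v hu hv (OrderDual.toDual_lt_toDual.2 h)⟩

theorem exists_isBFSOrder {V : Type*} [Finite V] (T : SimpleGraph V) (p : V) :
    ∃ pos, IsBFSOrder T p pos := by
  obtain ⟨pos, h1, h2⟩ := exists_bijOn_of_key p (T.dist p)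
  exact ⟨pos, h1, h2⟩

theorem _root_.SimpleGraph.Connected.map_of_surjective {V W : Type*} {G : SimpleGraph V}
    (hG : G.Connected) (f : V → W) (hf : Function.Surjective f) : (G.map f).Connected := by
  have := hG.nonempty.map f
  refine Connected.mk fun a b => ?_
  obtain ⟨u, rfl⟩ := hf a
  obtain ⟨v, rfl⟩ := hf b
  obtain ⟨q⟩ := hG.preconnected u v
  induction q with
  | nil => rfl
  | @cons u w v h q ih =>
    refine Reachable.trans ?_ ih
    by_cases huw : f u = f w
    · rw [huw]
    · exact Adj.reachable ⟨huw, u, w, h, rfl, rfl⟩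

theorem contractMap_surjective {V : Type*} {S : Set V} (hS : S.Nonempty) :
    Function.Surjective (contractMap S) := by
  rintro (_ | v)
  · exact ⟨hS.some, contractMap_of_mem hS.some_mem⟩
  · exact ⟨v, contractMap_of_notMem v.2⟩

theorem exists_labelling {V : Type*} {G : SimpleGraph V} (Q : Sym2 V → ℕ → Prop)
    (hQ : ∀ e, {t | Q e t}.Finite) :
    ∃ lam : G.EdgeLabeling (Finset ℕ), ∀ (e : G.edgeSet) (t : ℕ), t ∈ lam e ↔ Q e t := by
  let lam : G.edgeSet → Finset ℕ := fun e => (hQ e).toFinset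
  exact ⟨lam, fun e t => Set.Finite.mem_toFinset (hQ e)⟩

variable {V : Type*} [Finite V]

theorem exists_isPivotLabelling [Nonempty V] (G : SimpleGraph V) :
    ∃ lam : G.EdgeLabeling (Finset ℕ), IsPivotLabelling lam := by
  obtain ⟨p⟩ := ‹Nonempty V›
  obtain ⟨fst, hfst⟩ := exists_isReverseBFSOrder G p
  obtain ⟨snd, hsnd⟩ := exists_isBFSOrder G p
  obtain ⟨lam, hlam⟩ := exists_labelling (G := G) (fun e t =>
      (∃ v, IsEdgeTowards G p v e ∧ t = fst v) ∨
      (∃ v, IsEdgeTowards G p v e ∧ fst v ≠ Nat.card V - 1 ∧ t = (Nat.card V - 1) + snd v)) <| by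
    intro e
    refine ((Set.finite_range fst).union
      (Set.finite_range fun v => (Nat.card V - 1) + snd v)).subset ?_
    rintro t (⟨v, -, rfl⟩ | ⟨v, -, -, rfl⟩)
    · exact .inl ⟨v, rfl⟩
    · exact .inr ⟨v, rfl⟩
  exact ⟨lam, p, fst, snd, hfst, hsnd, hlam⟩

theorem exists_isCycle_length_eq_circumference {G : SimpleGraph V} (hG : ¬ G.IsAcyclic) :
    ∃ (r : V) (C : G.Walk r r), C.IsCycle ∧ C.length = circumference G := by
  rw [circumference, if_neg hG]
  refine Nat.sSup_mem (s := {k | ∃ (v : V) (p : G.Walk v v), p.IsCycle ∧ p.length = k})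
    ?_ ⟨Nat.card V, ?_⟩
  · unfold IsAcyclic at hG
    push Not at hG
    obtain ⟨v, p, hp⟩ := hG
    exact ⟨_, v, p, hp, rfl⟩
  · rintro k ⟨v, p, hp, rfl⟩
    rw [← hp.card_support]
    exact Set.ncard_le_card _

theorem exists_isCycleCombinedLabelling {G : SimpleGraph V} (hG : G.Connected)
    (hG' : ¬ G.IsAcyclic) : ∃ lam : G.EdgeLabeling (Finset ℕ), IsCycleCombinedLabelling lam := by
  classical
  obtain ⟨r, C, hC, hlen⟩ := exists_isCycle_length_eq_circumference hG'
  obtain ⟨T, hTG, hT⟩ := (hG.map_of_surjective (contractMap {v | v ∈ C.support})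
    (contractMap_surjective ⟨r, C.start_mem_support⟩)).exists_isTree_le
  obtain ⟨fst, hfst⟩ := exists_isReverseBFSOrder T none
  obtain ⟨snd, hsnd⟩ := exists_isBFSOrder T none
  obtain ⟨lam, hlam⟩ := exists_labelling (G := G) (fun e t =>
      (∃ v, IsEdgeTowards T none v (Sym2.map (contractMap {v | v ∈ C.support}) e) ∧ t = fst v) ∨
      (∃ i, C.edges[i]? = some (e : Sym2 V) ∧ ∃ s ∈ generatorLabels (circumference G) i,
        t = s + (Nat.card V - circumference G)) ∨
      (∃ v, IsEdgeTowards T none v (Sym2.map (contractMap {v | v ∈ C.support}) e) ∧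
        t = (Nat.card V - circumference G) + snd v +
          ((Nat.card V - circumference G) + generatorMax (circumference G) + 1))) <| by
    intro e
    refine ((Set.finite_range fst).union ((Set.Finite.biUnion (Set.finite_Iio C.length)
      fun i _ => ((generatorLabels (circumference G) i).image
        (· + (Nat.card V - circumference G))).finite_toSet).union
      (Set.finite_range fun v => (Nat.card V - circumference G) + snd v +
          ((Nat.card V - circumference G) + generatorMax (circumference G) + 1)))).subset ?_
    rintro t (⟨v, -, rfl⟩ | ⟨i, hi, s, hs, rfl⟩ | ⟨v, -, rfl⟩)
    · exact .inl ⟨v, rfl⟩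
    · exact .inr (.inl (Set.mem_biUnion ((getElem?_edges_iff C i e).1 hi).1
        (Finset.mem_coe.2 (Finset.mem_image_of_mem _ hs))))
    · exact .inr (.inr ⟨v, rfl⟩)
  exact ⟨lam, r, C, hC, hlen, T, hTG, hT, fst, snd, hfst, hsnd, hlam⟩

theorem exists_isCombinedLabelling {G : SimpleGraph V} (hG : G.Connected) :
    ∃ lam : G.EdgeLabeling (Finset ℕ), IsCombinedLabelling lam := by
  by_cases h : G.IsAcyclic
  · have := hG.nonempty
    obtain ⟨lam, hlam⟩ := exists_isPivotLabelling G
    exact ⟨lam, .inl ⟨h, hlam⟩⟩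
  · obtain ⟨lam, hlam⟩ := exists_isCycleCombinedLabelling hG h
    exact ⟨lam, .inr hlam⟩

end Existence

theorem IsCombinedLabelling.isExtremalLabelling {V : Type*} [Fintype V] [Nontrivial V]
    {G : SimpleGraph V} (hG : IsCactus G) {lam : G.EdgeLabeling (Finset ℕ)}
    (h : IsCombinedLabelling lam) : IsExtremalLabelling lam (circumference G) := by
  rcases h with ⟨hac, h⟩ | h
  · rw [circumference, if_pos hac]
    exact h.isExtremalLabelling ⟨hG.1, hac⟩
  · exact h.isExtremalLabelling hG

/-! ### Boundedness and the class parameters -/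

section Bounds

variable {V : Type*} {G : SimpleGraph V}

theorem _root_.List.Forall₂.exists_sublist_left {α β : Type*} {R : α → β → Prop} {l l' : List α}
    (h : l'.Sublist l) : ∀ {ts : List β}, List.Forall₂ R l ts → ∃ ts', ts'.Sublist ts ∧
      List.Forall₂ R l' ts' := by
  induction h with
  | slnil => exact fun h => ⟨_, List.Sublist.refl _, h⟩
  | cons a _ ih =>
    rintro _ (_ | ⟨h1, h2⟩)
    obtain ⟨ts', h3, h4⟩ := ih h2
    exact ⟨ts', h3.cons _, h4⟩
  | cons_cons a _ ih =>
    rintro _ (_ | ⟨h1, h2⟩)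
    obtain ⟨ts', h3, h4⟩ := ih h2
    exact ⟨_ :: ts', h3.cons_cons _, .cons h1 h4⟩

/-- Cutting loops out of a walk keeps a sublist of its edges, and the matching sublist of times is
still increasing. -/
theorem Reaches.exists_isPath {lam : G.EdgeLabeling (Finset ℕ)} {u v : V} (h : Reaches lam u v) :
    ∃ (p : G.Walk u v) (ts : List ℕ), p.IsPath ∧ List.Forall₂ (HasLabel lam) p.edges ts ∧
      ts.Pairwise (· < ·) := by
  classical
  obtain ⟨p, ts, hf, hp⟩ := h
  obtain ⟨ts', h1, h2⟩ := List.Forall₂.exists_sublist_left p.edges_bypass_sublist_edges hf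
  exact ⟨p.bypass, ts', p.bypass_isPath, h2, hp.sublist h1⟩

theorem hasLabel_removeLabel {lam : G.EdgeLabeling (Finset ℕ)} {e : G.edgeSet} {t₀ : ℕ}
    {e' : Sym2 V} {t : ℕ} : HasLabel (removeLabel lam e t₀) e' t ↔
      HasLabel lam e' t ∧ ¬ (e' = (e : Sym2 V) ∧ t = t₀) := by
  induction e' with
  | h x y => exact labelRel_removeLabel

variable [Fintype V]

/-- Fix one time-respecting path for each of the n² ordered pairs; each has fewer than n edges. A
label used by none of them could be removed without losing connectivity. The bound matters because
the supremum in ℕ of an unbounded set is 0. -/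
theorem temporalCost_le {lam : G.EdgeLabeling (Finset ℕ)} (hmin : IsMinimal lam)
    (hconn : IsTemporallyConnected lam) : temporalCost lam ≤ Fintype.card V ^ 3 := by
  classical
  choose p ts hpath hf hlt using fun x : V × V => (hconn x.1 x.2).exists_isPath
  let U : Finset (Sym2 V × ℕ) := Finset.univ.biUnion fun x => ((p x).edges.zip (ts x)).toFinset
  have hU : U.card ≤ Fintype.card V ^ 3 := by
    refine (Finset.card_biUnion_le_card_mul _ _ (Fintype.card V) fun x _ => ?_).trans_eq ?_
    · refine (List.toFinset_card_le _).trans ?_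
      have := (hpath x).length_lt
      rw [List.length_zip, Walk.length_edges]
      omega
    · rw [Finset.card_univ, Fintype.card_prod]
      ring
  refine le_trans ?_ hU
  have hmem : ∀ (e : G.edgeSet), ∀ t ∈ lam e, ((e : Sym2 V), t) ∈ U := by
    intro e t ht
    by_contra hU
    refine hmin e t ht (hconn.reachabilityEquivalent_iff.2 fun u v => ?_)
    refine ⟨p (u, v), ts (u, v), ?_, hlt _⟩
    have := List.forall₂_iff_zip.1 (hf (u, v))
    refine List.forall₂_iff_zip.2 ⟨this.1, fun {a b} hab => ?_⟩
    refine hasLabel_removeLabel.2 ⟨this.2 hab, ?_⟩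
    rintro ⟨rfl, rfl⟩
    exact hU (Finset.mem_biUnion.2 ⟨(u, v), Finset.mem_univ _, List.mem_toFinset.2 hab⟩)
  unfold temporalCost
  have := Finset.card_sigma (Finset.univ : Finset G.edgeSet) (fun e => (lam e : Finset ℕ))
  rw [← this]
  refine Finset.card_le_card_of_injOn (fun x => ((x.1 : Sym2 V), x.2)) ?_ ?_
  · rintro ⟨e, t⟩ h
    exact hmem e t (Finset.mem_sigma.1 h).2
  · rintro ⟨e, t⟩ _ ⟨e', t'⟩ _ h
    obtain ⟨h1, h2⟩ := Prod.mk.inj h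
    obtain rfl : e = e' := Subtype.ext h1
    obtain rfl : t = t' := h2
    rfl

theorem temporality_le_temporalCost (lam : G.EdgeLabeling (Finset ℕ)) :
    temporality lam ≤ temporalCost lam := by
  classical
  refine Finset.sup_le fun e he => ?_
  exact Finset.single_le_sum (f := fun e : G.edgeSet => (lam e).card) (fun _ _ => Nat.zero_le _) he

theorem IsExtremalLabelling.temporalCost_le_maxTemporalCost {lam : G.EdgeLabeling (Finset ℕ)}
    {c : ℕ} (h : IsExtremalLabelling lam c) : temporalCost lam ≤ maxTemporalCost G := by
  refine le_csSup ⟨Fintype.card V ^ 3, ?_⟩ ⟨lam, h.proper, h.minimal, h.connected, rfl⟩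
  rintro k ⟨mu, -, h1, h2, rfl⟩
  exact temporalCost_le h1 h2

theorem IsExtremalLabelling.temporality_le_maxTemporality {lam : G.EdgeLabeling (Finset ℕ)}
    {c : ℕ} (h : IsExtremalLabelling lam c) : temporality lam ≤ maxTemporality G := by
  refine le_csSup ⟨Fintype.card V ^ 3, ?_⟩ ⟨lam, h.proper, h.minimal, h.connected, rfl⟩
  rintro k ⟨mu, -, h1, h2, rfl⟩
  exact (temporality_le_temporalCost mu).trans (temporalCost_le h1 h2)

theorem le_classMaxTemporalCost {K : Set (SimpleGraph V)} (hK : K.Nonempty) {x : ℕ}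
    (h : ∀ G ∈ K, x ≤ maxTemporalCost G) : x ≤ classMaxTemporalCost K :=
  le_csSup ⟨maxTemporalCost hK.some, fun _ hy => hy _ hK.some_mem⟩ h

theorem le_classMaxTemporality {K : Set (SimpleGraph V)} (hK : K.Nonempty) {x : ℕ}
    (h : ∀ G ∈ K, x ≤ maxTemporality G) : x ≤ classMaxTemporality K :=
  le_csSup ⟨maxTemporality hK.some, fun _ hy => hy _ hK.some_mem⟩ h

theorem sq_div_add_le {c n k : ℕ} (hc : c ≤ n) (h : c ^ 2 + 8 * (n - c) ≤ 4 * k) :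
    (c : ℝ) ^ 2 / 4 + 2 * ((n : ℝ) - (c : ℝ)) ≤ k := by
  have : (c : ℝ) ^ 2 + 8 * ((n : ℝ) - c) ≤ 4 * k := by
    rw [← Nat.cast_sub hc]
    exact_mod_cast h
  linarith

theorem ceil_half_le {c k : ℕ} (h : (c + 1) / 2 ≤ k) : ⌈(c : ℝ) / 2⌉₊ ≤ k := by
  rw [Nat.ceil_le, div_le_iff₀ two_pos]
  have : c ≤ k * 2 := by omega
  exact_mod_cast this

end Bounds

end TemporalGraph

theorem mainTheorem11 {V : Type*} [Fintype V] [Nontrivial V] (c : ℕ) :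
    (∀ G ∈ TemporalGraph.circumferenceCacti V c,
      (∃ lam : G.EdgeLabeling (Finset ℕ), TemporalGraph.IsCombinedLabelling lam) ∧
      ∀ lam : G.EdgeLabeling (Finset ℕ), TemporalGraph.IsCombinedLabelling lam →
        TemporalGraph.IsProper lam ∧
        TemporalGraph.IsMinimal lam ∧
        TemporalGraph.IsTemporallyConnected lam ∧
        (c : ℝ) ^ 2 / 4 + 2 * ((Fintype.card V : ℝ) - (c : ℝ)) ≤
          (TemporalGraph.temporalCost lam : ℝ) ∧
        ⌈(c : ℝ) / 2⌉₊ ≤ TemporalGraph.temporality lam) ∧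
    ((TemporalGraph.circumferenceCacti V c).Nonempty →
      (c : ℝ) ^ 2 / 4 + 2 * ((Fintype.card V : ℝ) - (c : ℝ)) ≤
        (TemporalGraph.classMaxTemporalCost (TemporalGraph.circumferenceCacti V c) : ℝ) ∧
      ⌈(c : ℝ) / 2⌉₊ ≤
        TemporalGraph.classMaxTemporality (TemporalGraph.circumferenceCacti V c)) := by
  have hex : ∀ G ∈ TemporalGraph.circumferenceCacti V c,
      ∃ lam : G.EdgeLabeling (Finset ℕ), TemporalGraph.IsCombinedLabelling lam :=
    fun G hG => TemporalGraph.exists_isCombinedLabelling hG.1.1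
  have hext : ∀ G ∈ TemporalGraph.circumferenceCacti V c, ∀ lam : G.EdgeLabeling (Finset ℕ),
      TemporalGraph.IsCombinedLabelling lam → TemporalGraph.IsExtremalLabelling lam c := by
    rintro G ⟨hG, rfl⟩ lam h
    exact h.isExtremalLabelling hG
  refine ⟨fun G hG => ⟨hex G hG, fun lam hlam => ?_⟩, fun hne => ?_⟩
  · have h := hext G hG lam hlam
    exact ⟨h.proper, h.minimal, h.connected, TemporalGraph.sq_div_add_le h.le_card h.le_cost,
      TemporalGraph.ceil_half_le h.le_temporality⟩
  · obtain ⟨G, hG⟩ := id hne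
    obtain ⟨lam, hlam⟩ := hex G hG
    refine ⟨TemporalGraph.sq_div_add_le (hext G hG lam hlam).le_card ?_,
      TemporalGraph.le_classMaxTemporality hne ?_⟩
    -- The class parameter is a natural number, so the bound is first rounded up to the integer
    -- ⌈c²/4 + 2(n - c)⌉.
    · have hle : (c ^ 2 + 8 * (Fintype.card V - c) + 3) / 4 ≤
          TemporalGraph.classMaxTemporalCost (TemporalGraph.circumferenceCacti V c) := by
        refine TemporalGraph.le_classMaxTemporalCost hne fun G hG => ?_
        obtain ⟨lam, hlam⟩ := hex G hG
        have h := hext G hG lam hlam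
        have := h.le_cost
        exact le_trans (by omega) h.temporalCost_le_maxTemporalCost
      omega
    · intro G hG
      obtain ⟨lam, hlam⟩ := hex G hG
      have h := hext G hG lam hlam
      exact (TemporalGraph.ceil_half_le h.le_temporality).trans h.temporality_le_maxTemporality
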